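/- Let $k$ be a field. For a finite directed graph (quiver) $Q$, with finitely many vertices and finitely many arrows (loops and multiple arrows allowed), let $kQ$ be its path algebra: it has as a basis the finite paths in $Q$, including the trivial path at each vertex, and the product $qp$ of two paths is the path "first $p$, then $q$" if $q$ starts where $p$ ends, and $0$ otherwise. Grade $kQ$ by path length. Let $\mathsf{Gr}\,kQ$ be the category of $\mathbb{Z}$-graded left $kQ$-modules with degree-preserving homomorphisms, let $\mathsf{Fdim}\,kQ$ be its full subcategory of modules that are the sum of their finite-dimensional graded submodules (a Serre subcategory), and let $\mathsf{QGr}\,kQ := \mathsf{Gr}\,kQ/\mathsf{Fdim}\,kQ$ be the quotient category, i.e. the localization of $\mathsf{Gr}\,kQ$ at the morphisms whose kernel and cokernel lie in $\mathsf{Fdim}\,kQ$. The incidence matrix of $Q$ is the square matrix, indexed by the vertices, whose $(i,j)$ entry is the number of arrows from $j$ to $i$. Two square matrices $A$ and $B$ with entries in $\mathbb{N}=\{0,1,2,\dots\}$, possibly of different sizes, are shift equivalent if there are a positive integer $\ell$ and matrices $L$ and $R$ with entries in $\mathbb{N}$ such that $$AL=LB,\qquad RA=BR,\qquad A^{\ell}=LR,\qquad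 B^{\ell}=RL.$$ **Corollary 1.3.** Let $Q$ and $Q'$ be finite quivers. If the incidence matrices of $Q$ and $Q'$ are shift equivalent, then there is an equivalence of categories $\mathsf{QGr}(kQ)\simeq\mathsf{QGr}(kQ')$. -/

import Mathlib

open CategoryTheory

universe u v w

/-! ## Path algebras of quivers -/

/-- All finite paths in a quiver (including the trivial path at each vertex). -/
structure QPath (V : Type v) [Quiver.{w} V] where
  /-- the vertex at which the path starts -/
  src : V
  /-- the vertex at which the path terminates -/
  tgt : V
  /-- the path itself -/
  path : Quiver.Path src tgt

/-- The underlying vector space of the path algebra: it has the finite paths as a basis. -/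
def PathAlgebra (k : Type u) [Field k] (V : Type v) [Quiver.{w} V] : Type (max u v w) :=
  QPath V →₀ k

namespace PathAlgebra

variable (k : Type u) [Field k] (V : Type v) [Quiver.{w} V]

noncomputable instance : AddCommGroup (PathAlgebra k V) :=
  inferInstanceAs (AddCommGroup (QPath V →₀ k))

noncomputable instance : Module k (PathAlgebra k V) :=
  inferInstanceAs (Module k (QPath V →₀ k))

variable {V}

/-- The basis element of the path algebra given by a path. -/
noncomputable def ofPath (p : QPath V) : PathAlgebra k V := Finsupp.single p (1 : k)

open Classical in
/-- The product of two paths: `q` times `p` is the path "first traverse `p`, then traverse `q`" if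
`q` starts where `p` terminates, and zero otherwise. -/
noncomputable def pathMul (q p : QPath V) : PathAlgebra k V :=
  if h : q.src = p.tgt then ofPath k ⟨p.src, q.tgt, p.path.comp (q.path.cast h rfl)⟩ else 0

variable (V)

/-- The multiplication of the path algebra: the bilinear extension of the product of paths. -/
noncomputable def mulBilin : PathAlgebra k V →ₗ[k] PathAlgebra k V →ₗ[k] PathAlgebra k V :=
  Finsupp.linearCombination k fun q : QPath V =>
    (Finsupp.linearCombination k fun p : QPath V => pathMul k q p :
      (QPath V →₀ k) →ₗ[k] PathAlgebra k V)

noncomputable instance : Mul (PathAlgebra k V) := ⟨fun x y => mulBilin k V x y⟩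

/-- The identity of the path algebra: the sum of the trivial paths. -/
noncomputable instance [Fintype V] : One (PathAlgebra k V) :=
  ⟨∑ i : V, ofPath k ⟨i, i, Quiver.Path.nil⟩⟩

variable {k V}

theorem mul_def (x y : PathAlgebra k V) : x * y = mulBilin k V x y := rfl

theorem one_def [Fintype V] :
    (1 : PathAlgebra k V) = ∑ i : V, ofPath k ⟨i, i, Quiver.Path.nil⟩ := rfl

theorem ofPath_mul_ofPath (q p : QPath V) : ofPath k q * ofPath k p = pathMul k q p := by
  have h : mulBilin k V (ofPath k q) = (Finsupp.linearCombination k fun p => pathMul k q p) :=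
    (Finsupp.linearCombination_single k (1 : k) q).trans (one_smul k _)
  rw [mul_def, h]
  exact (Finsupp.linearCombination_single k (1 : k) p).trans (one_smul k _)

theorem induction_on {P : PathAlgebra k V → Prop} (x : PathAlgebra k V) (zero : P 0)
    (add : ∀ x y, P x → P y → P (x + y)) (smul : ∀ (c : k) (p : QPath V), P (c • ofPath k p)) :
    P x :=
  Finsupp.induction_linear x zero (fun f g hf hg => add f g hf hg) fun p c => by
    have h : (Finsupp.single p c : QPath V →₀ k) = c • Finsupp.single p (1 : k) := by simp
    rw [h]
    exact smul c p

theorem ofPath_mul_of_eq {a b c : V} (q : Quiver.Path b c) (p : Quiver.Path a b) :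
    ofPath k ⟨b, c, q⟩ * ofPath k ⟨a, b, p⟩ = ofPath k ⟨a, c, p.comp q⟩ := by
  simp [ofPath_mul_ofPath, pathMul]

theorem ofPath_mul_of_ne (q p : QPath V) (h : q.src ≠ p.tgt) :
    ofPath k q * ofPath k p = 0 := by
  simp [ofPath_mul_ofPath, pathMul, h]

protected theorem add_mul' (x y z : PathAlgebra k V) : (x + y) * z = x * z + y * z := by
  simp [mul_def]

protected theorem mul_add' (x y z : PathAlgebra k V) : x * (y + z) = x * y + x * z := by
  simp [mul_def]

protected theorem zero_mul' (x : PathAlgebra k V) : 0 * x = 0 := by simp [mul_def]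

protected theorem mul_zero' (x : PathAlgebra k V) : x * 0 = 0 := by simp [mul_def]

protected theorem smul_mul' (c : k) (x y : PathAlgebra k V) : (c • x) * y = c • (x * y) := by
  simp [mul_def]

protected theorem mul_smul' (c : k) (x y : PathAlgebra k V) : x * (c • y) = c • (x * y) := by
  simp [mul_def]

protected theorem mul_assoc' (x y z : PathAlgebra k V) : x * y * z = x * (y * z) := by
  have key : ∀ r q p : QPath V,
      ofPath k r * ofPath k q * ofPath k p = ofPath k r * (ofPath k q * ofPath k p) := by
    rintro ⟨c, d, r⟩ ⟨b, c', q⟩ ⟨a, b', p⟩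
    by_cases h₁ : c = c'
    · subst h₁
      by_cases h₂ : b = b'
      · subst h₂
        simp only [ofPath_mul_of_eq, Quiver.Path.comp_assoc]
      · rw [ofPath_mul_of_eq, ofPath_mul_of_ne _ _ h₂, ofPath_mul_of_ne _ _ h₂, PathAlgebra.mul_zero']
    · rw [ofPath_mul_of_ne _ _ h₁, PathAlgebra.zero_mul']
      by_cases h₂ : b = b'
      · subst h₂
        rw [ofPath_mul_of_eq, ofPath_mul_of_ne _ _ h₁]
      · rw [ofPath_mul_of_ne _ _ h₂, PathAlgebra.mul_zero']
  induction x using induction_on with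
  | zero => simp only [PathAlgebra.zero_mul']
  | add x x' hx hx' => simp only [PathAlgebra.add_mul', hx, hx']
  | smul c r =>
    induction y using induction_on with
    | zero => simp only [PathAlgebra.zero_mul', PathAlgebra.mul_zero']
    | add y y' hy hy' => simp only [PathAlgebra.add_mul', PathAlgebra.mul_add', hy, hy']
    | smul d q =>
      induction z using induction_on with
      | zero => simp only [PathAlgebra.mul_zero']
      | add z z' hz hz' => simp only [PathAlgebra.mul_add', hz, hz']
      | smul e p => simp only [PathAlgebra.smul_mul', PathAlgebra.mul_smul', key]

protected theorem one_mul' [Fintype V] (x : PathAlgebra k V) : 1 * x = x := by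
  classical
  have hs : ∀ (s : Finset V) (f : V → PathAlgebra k V) (z : PathAlgebra k V),
      (∑ i ∈ s, f i) * z = ∑ i ∈ s, f i * z := fun s f z => by
    simp [mul_def]
  induction x using induction_on with
  | zero => exact PathAlgebra.mul_zero' _
  | add x y hx hy => rw [PathAlgebra.mul_add', hx, hy]
  | smul c p =>
    obtain ⟨a, b, p⟩ := p
    rw [PathAlgebra.mul_smul', one_def, hs, Finset.sum_eq_single b]
    · rw [ofPath_mul_of_eq, Quiver.Path.comp_nil]
    · intro i _ hi
      exact ofPath_mul_of_ne _ _ hi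
    · simp

protected theorem mul_one' [Fintype V] (x : PathAlgebra k V) : x * 1 = x := by
  classical
  have hs : ∀ (s : Finset V) (f : V → PathAlgebra k V) (z : PathAlgebra k V),
      z * (∑ i ∈ s, f i) = ∑ i ∈ s, z * f i := fun s f z => by
    simp [mul_def]
  induction x using induction_on with
  | zero => exact PathAlgebra.zero_mul' _
  | add x y hx hy => rw [PathAlgebra.add_mul', hx, hy]
  | smul c p =>
    obtain ⟨a, b, p⟩ := p
    rw [PathAlgebra.smul_mul', one_def, hs, Finset.sum_eq_single a]
    · rw [ofPath_mul_of_eq, Quiver.Path.nil_comp]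
    · intro i _ hi
      exact ofPath_mul_of_ne _ _ hi.symm
    · simp

noncomputable instance [Fintype V] : Ring (PathAlgebra k V) where
  __ := (inferInstance : AddCommGroup (PathAlgebra k V))
  mul := (· * ·)
  one := 1
  left_distrib := PathAlgebra.mul_add'
  right_distrib := PathAlgebra.add_mul'
  zero_mul := PathAlgebra.zero_mul'
  mul_zero := PathAlgebra.mul_zero'
  mul_assoc := PathAlgebra.mul_assoc'
  one_mul := PathAlgebra.one_mul'
  mul_one := PathAlgebra.mul_one'

noncomputable instance [Fintype V] : Algebra k (PathAlgebra k V) :=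
  Algebra.ofModule PathAlgebra.smul_mul' PathAlgebra.mul_smul'

variable (k V)

/-- The degree `n` component of the path algebra: the linear span of the paths of length `n`. -/
noncomputable def degree (n : ℕ) : Submodule k (PathAlgebra k V) :=
  Submodule.span k {x | ∃ p : QPath V, p.path.length = n ∧ x = ofPath k p}

end PathAlgebra

/-! ## Graded modules over path algebras -/

/-- A `ℤ`-graded left module over the path algebra `kQ` of a quiver `Q` with vertex set `V`. The
action of `k` is the one through `k → kQ`. -/
structure GrMod (k : Type u) [Field k] (V : Type v) [Quiver.{w} V] [Fintype V] where
  /-- the underlying set -/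
  carrier : Type u
  [addCommGroup : AddCommGroup carrier]
  [moduleBase : Module k carrier]
  [module : Module (PathAlgebra k V) carrier]
  [isScalarTower : IsScalarTower k (PathAlgebra k V) carrier]
  /-- the homogeneous components -/
  grading : ℤ → Submodule k carrier
  isInternal : DirectSum.IsInternal grading
  smul_mem : ∀ (n : ℕ) (i : ℤ) (a : PathAlgebra k V) (m : carrier),
    a ∈ PathAlgebra.degree k V n → m ∈ grading i → a • m ∈ grading (n + i)

namespace GrMod

attribute [instance] addCommGroup moduleBase module isScalarTower

variable {k : Type u} [Field k] {V : Type v} [Quiver.{w} V] [Fintype V]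

instance : CoeSort (GrMod k V) (Type u) := ⟨carrier⟩

/-- Degree-preserving homomorphisms of graded modules. -/
@[ext]
structure Hom (M N : GrMod k V) where
  /-- the underlying homomorphism of modules -/
  toLinearMap : M →ₗ[PathAlgebra k V] N
  map_mem : ∀ (i : ℤ) (m : M), m ∈ M.grading i → toLinearMap m ∈ N.grading i

/-- The category of `ℤ`-graded left modules over the path algebra. -/
noncomputable instance : Category (GrMod k V) where
  Hom := Hom
  id M := ⟨LinearMap.id, fun _ _ h => h⟩
  comp f g := ⟨g.toLinearMap.comp f.toLinearMap,
    fun i m h => g.map_mem i _ (f.map_mem i m h)⟩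

/-- The projection of a graded module to its homogeneous component of degree `i`. -/
noncomputable def proj (M : GrMod k V) (i : ℤ) : M →ₗ[k] M :=
  (M.grading i).subtype ∘ₗ DirectSum.component k ℤ (fun i => M.grading i) i ∘ₗ
    (LinearEquiv.ofBijective (DirectSum.coeLinearMap M.grading) M.isInternal).symm.toLinearMap

theorem proj_mem (M : GrMod k V) (i : ℤ) (m : M) : M.proj i m ∈ M.grading i :=
  Submodule.coe_mem _

theorem proj_of_mem (M : GrMod k V) {i : ℤ} {m : M} (h : m ∈ M.grading i) : M.proj i m = m :=
  congrArg Subtype.val (M.isInternal.ofBijective_coeLinearMap_of_mem h)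

theorem proj_of_mem_ne (M : GrMod k V) {i j : ℤ} (hij : i ≠ j) {m : M} (h : m ∈ M.grading i) :
    M.proj j m = 0 := by
  exact congrArg Subtype.val (M.isInternal.ofBijective_coeLinearMap_of_mem_ne hij h)

theorem induction_on (M : GrMod k V) {P : M → Prop} (m : M) (zero : P 0)
    (add : ∀ x y, P x → P y → P (x + y)) (mem : ∀ (i : ℤ) (x : M), x ∈ M.grading i → P x) :
    P m :=
  Submodule.iSup_induction M.grading (motive := P)
    (by rw [M.isInternal.submodule_iSup_eq_top]; trivial) mem zero add

theorem map_proj {M N : GrMod k V} (f : M ⟶ N) (i : ℤ) (m : M) :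
    f.toLinearMap (M.proj i m) = N.proj i (f.toLinearMap m) := by
  induction m using M.induction_on with
  | zero => simp
  | add x y hx hy => simp [hx, hy]
  | mem j x hx =>
    by_cases h : j = i
    · subst h
      rw [proj_of_mem _ hx, proj_of_mem _ (f.map_mem _ _ hx)]
    · rw [proj_of_mem_ne _ h hx, proj_of_mem_ne _ h (f.map_mem _ _ hx), map_zero]

theorem exists_sum_proj (M : GrMod k V) (m : M) : ∃ s : Finset ℤ, m = ∑ i ∈ s, M.proj i m := by
  classical
  suffices h : ∃ s : Finset ℤ, ∀ t, s ⊆ t → m = ∑ i ∈ t, M.proj i m from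
    h.imp fun s hs => hs s subset_rfl
  induction m using M.induction_on with
  | zero => exact ⟨∅, by simp⟩
  | add x y hx hy =>
    obtain ⟨s, hs⟩ := hx
    obtain ⟨t, ht⟩ := hy
    refine ⟨s ∪ t, fun r hr => ?_⟩
    simp only [map_add, Finset.sum_add_distrib]
    rw [← hs r (Finset.union_subset_left hr), ← ht r (Finset.union_subset_right hr)]
  | mem j x hx =>
    refine ⟨{j}, fun t ht => ?_⟩
    rw [Finset.sum_eq_single_of_mem j (by simpa using ht)
      (fun i _ hi => proj_of_mem_ne _ (Ne.symm hi) hx), proj_of_mem _ hx]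

theorem iSupIndep_of_proj {E F : Type*} [AddCommGroup E] [Module k E] [AddCommGroup F] [Module k F]
    (A : ℤ → Submodule k E) (p : ℤ → E →ₗ[k] F) (h₁ : ∀ i, ∀ x ∈ A i, p i x = 0 → x = 0)
    (h₂ : ∀ i j, i ≠ j → ∀ x ∈ A i, p j x = 0) : iSupIndep A := by
  intro i
  rw [Submodule.disjoint_def]
  intro x hx hx'
  refine h₁ i x hx ?_
  have : (⨆ (j) (_ : j ≠ i), A j) ≤ LinearMap.ker (p i) :=
    iSup₂_le fun j hj y hy => h₂ j i hj y hy
  exact this hx'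

/-- The kernel of a morphism of graded modules, with the grading it inherits from the source. -/
noncomputable def ker {M N : GrMod k V} (f : M ⟶ N) : GrMod k V where
  carrier := LinearMap.ker f.toLinearMap
  grading i := (M.grading i).comap ((LinearMap.ker f.toLinearMap).subtype.restrictScalars k)
  isInternal := by
    rw [DirectSum.isInternal_submodule_iff_iSupIndep_and_iSup_eq_top]
    constructor
    · refine iSupIndep_of_proj _
        (fun i => M.proj i ∘ₗ (LinearMap.ker f.toLinearMap).subtype.restrictScalars k) ?_ ?_
      · intro i x hx h
        exact Subtype.ext ((proj_of_mem M hx).symm.trans h)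
      · intro i j hij x hx
        exact proj_of_mem_ne M hij hx
    · rw [eq_top_iff]
      rintro ⟨x, hx⟩ -
      have hp : ∀ i, M.proj i x ∈ LinearMap.ker f.toLinearMap := fun i => by
        rw [LinearMap.mem_ker] at hx ⊢
        rw [map_proj, hx, map_zero]
      obtain ⟨s, hs⟩ := M.exists_sum_proj x
      have : (⟨x, hx⟩ : LinearMap.ker f.toLinearMap) = ∑ i ∈ s, ⟨M.proj i x, hp i⟩ :=
        Subtype.ext (by simpa using hs)
      rw [this]
      exact Submodule.sum_mem _ fun i _ => Submodule.mem_iSup_of_mem i (proj_mem M i x)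
  smul_mem n i a m ha hm := M.smul_mem n i a m.1 ha hm

theorem isInternal_map (N : GrMod k V) {C : Type*} [AddCommGroup C] [Module k C] (π : N →ₗ[k] C)
    (hπ : Function.Surjective π) (h : ∀ i x, π x = 0 → π (N.proj i x) = 0) :
    DirectSum.IsInternal fun i => (N.grading i).map π := by
  have hq : ∀ i, ∃ q : C →ₗ[k] C, ∀ x, q (π x) = π (N.proj i x) := fun i =>
    ⟨(LinearMap.ker π).liftQ (π ∘ₗ N.proj i) (fun x hx => h i x (LinearMap.mem_ker.1 hx)) ∘ₗ
      (π.quotKerEquivOfSurjective hπ).symm.toLinearMap, fun x => by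
        have : (π.quotKerEquivOfSurjective hπ).symm (π x) = (LinearMap.ker π).mkQ x := by
          rw [LinearEquiv.symm_apply_eq]
          rfl
        rw [LinearMap.comp_apply, LinearEquiv.coe_coe, this, Submodule.mkQ_apply]
        exact Submodule.liftQ_apply _ _ _⟩
  choose q hq using hq
  rw [DirectSum.isInternal_submodule_iff_iSupIndep_and_iSup_eq_top]
  constructor
  · refine iSupIndep_of_proj _ q ?_ ?_
    · rintro i _ ⟨x, hx, rfl⟩ h0
      rwa [hq, proj_of_mem N hx] at h0
    · rintro i j hij _ ⟨x, hx, rfl⟩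
      rw [hq, proj_of_mem_ne N hij hx, map_zero]
  · rw [← Submodule.map_iSup, N.isInternal.submodule_iSup_eq_top, Submodule.map_top,
      LinearMap.range_eq_top]
    exact hπ

theorem coker_isInternal {M N : GrMod k V} (f : M ⟶ N) :
    DirectSum.IsInternal fun i =>
      (N.grading i).map ((LinearMap.range f.toLinearMap).mkQ.restrictScalars k) := by
  refine N.isInternal_map ((LinearMap.range f.toLinearMap).mkQ.restrictScalars k) ?_ ?_
  · exact Submodule.mkQ_surjective (LinearMap.range f.toLinearMap)
  intro i x hx
  have hx' : x ∈ LinearMap.range f.toLinearMap := (Submodule.Quotient.mk_eq_zero _).1 hx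
  obtain ⟨m, rfl⟩ := hx'
  exact (Submodule.Quotient.mk_eq_zero _).2 ⟨M.proj i m, map_proj f i m⟩

/-- The cokernel of a morphism of graded modules, with the grading it inherits from the target. -/
noncomputable def coker {M N : GrMod k V} (f : M ⟶ N) : GrMod k V where
  carrier := N ⧸ LinearMap.range f.toLinearMap
  grading i := (N.grading i).map ((LinearMap.range f.toLinearMap).mkQ.restrictScalars k)
  isInternal := coker_isInternal f
  smul_mem := by
    rintro n i a _ ha ⟨m, hm, rfl⟩
    exact ⟨a • m, N.smul_mem n i a m ha hm, rfl⟩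

variable (k V)

/-- `Fdim kQ`: the graded modules that are the sum of their finite-dimensional graded
submodules. -/
def Fdim : ObjectProperty (GrMod k V) := fun M =>
  (⨆ (N : Submodule (PathAlgebra k V) M) (_ : (∀ i, ∀ m ∈ N, M.proj i m ∈ N) ∧ Module.Finite k N),
    N) = ⊤

/-- The morphisms of graded modules whose kernel and cokernel belong to `Fdim kQ`. -/
def isoModFdim : MorphismProperty (GrMod k V) := fun _ _ f =>
  Fdim k V (ker f) ∧ Fdim k V (coker f)

end GrMod

/-- `QGr kQ`: the quotient of the category of graded modules `Gr kQ` by its Serre subcategory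
`Fdim kQ`, i.e. the localization of `Gr kQ` at the morphisms whose kernel and cokernel belong
to `Fdim kQ`. -/
abbrev QGr (k : Type u) [Field k] (V : Type v) [Quiver.{w} V] [Fintype V] :=
  (GrMod.isoModFdim k V).Localization

/-! ## Incidence matrices and shift equivalence -/

/-- The incidence matrix of a finite quiver: its `(i, j)` entry is the number of arrows
from `j` to `i`. -/
def incidenceMatrix (V : Type v) [Quiver.{w} V] [∀ i j : V, Fintype (i ⟶ j)] : Matrix V V ℕ :=
  fun i j => Fintype.card (j ⟶ i)

/-- Shift equivalence of square matrices with non-negative integer entries. -/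
def ShiftEquivalent {m : Type*} {n : Type*} [Fintype m] [DecidableEq m] [Fintype n]
    [DecidableEq n] (A : Matrix m m ℕ) (B : Matrix n n ℕ) : Prop :=
  ∃ (l : ℕ) (L : Matrix m n ℕ) (R : Matrix n m ℕ),
    0 < l ∧ A * L = L * B ∧ R * A = B * R ∧ A ^ l = L * R ∧ B ^ l = R * L

-- A graded `kQ`-module `M` is the same thing as a representation of the covering quiver with
-- vertices `(i, n)`: the space at `(i, n)` is `e_i M_n`, and arrows raise the level `n` by one.
-- This is the equivalence `repFunctor`. Since `Q` is finite, `M` lies in `Fdim` exactly when every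
-- element is killed by all sufficiently long paths (`fdim_iff`). Hence the morphisms inverted in
-- `QGr kQ` correspond to `torsionIso`, a condition that concerns only what happens on high levels
-- (`isoModFdim_iff`).
--
-- Such a localization survives telescoping: keep the vertices on every `l`-th level, and take as
-- arrows the paths between consecutive kept levels (`telescope`). Restriction to the kept levels
-- has a fully faithful left adjoint, the left Kan extension, so it is itself a localization. A
-- morphism is a `torsionIso` if and only if its restriction is one, because every path that climbs
-- high enough crosses kept levels.
--
-- Let `A` and `B` be the two incidence matrices. Telescoping the covers by `l` gives the covers of
-- the quivers with matrices `A ^ l = L * R` and `B ^ l = R * L`. Both are telescopes of a single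
-- quiver whose levels alternate between the two vertex sets, with arrows counted in turn by `R` and
-- `L`: its even levels give `L * R`, its odd levels `R * L`.

universe v' w'

/-! ### Localization along an adjunction with invertible unit -/

theorem localization_equivalence_of_adjunction {C₁ : Type*} {C₂ : Type*} [Category C₁]
    [Category C₂] {G : C₂ ⥤ C₁} {F : C₁ ⥤ C₂} (adj : G ⊣ F) [IsIso adj.unit]
    (W₁ : MorphismProperty C₁) (W₂ : MorphismProperty C₂) [W₂.RespectsIso]
    (h : ∀ ⦃X Y : C₁⦄ (f : X ⟶ Y), W₁ f ↔ W₂ (F.map f))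
    (hiso : ∀ ⦃X Y : C₂⦄ (f : X ⟶ Y), IsIso f → W₂ f) :
    Nonempty (W₁.Localization ≌ W₂.Localization) := by
  -- An invertible unit makes the left adjoint `G` fully faithful, so `F` is a localization at the
  -- morphisms that it inverts.
  have : G.Full := adj.fullyFaithfulLOfIsIsoUnit.full
  have : G.Faithful := adj.fullyFaithfulLOfIsIsoUnit.faithful
  have : F.IsLocalization ((MorphismProperty.isomorphisms C₂).inverseImage F) :=
    adj.isLocalization'
  have : (F ⋙ W₂.Q).IsLocalization W₁ := by
    refine Functor.IsLocalization.comp F W₂.Q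
      ((MorphismProperty.isomorphisms C₂).inverseImage F) W₂ W₁ ?_ ?_ ?_
    · intro X Y f hf
      exact Localization.inverts W₂.Q W₂ _ ((h f).1 hf)
    · intro X Y f hf
      exact (h f).2 (hiso _ hf)
    · intro X Y f hf
      -- The unit identifies `f` with `F.map (G.map f)`, so `f` comes from `W₁` as soon as `G.map f`
      -- lies there.
      have hG : W₁ (G.map f) := (h _).2 <| by
        have := adj.unit.naturality f
        rw [← W₂.cancel_left_of_respectsIso (adj.unit.app X)]
        have e : adj.unit.app X ≫ F.map (G.map f) = f ≫ adj.unit.app Y := this.symm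
        rw [e]
        exact (W₂.cancel_right_of_respectsIso f (adj.unit.app Y)).2 hf
      refine (MorphismProperty.arrow_mk_iso_iff _ ?_).2 (MorphismProperty.map_mem_map W₁ F _ hG)
      exact Arrow.isoMk (asIso (adj.unit.app X)) (asIso (adj.unit.app Y))
        (adj.unit.naturality f).symm
  exact ⟨Localization.uniq W₁.Q (F ⋙ W₂.Q) W₁ |>.trans .refl⟩

/-! ### Paths in levelled quivers -/

namespace LevelQuiver

variable {D : Type v} [Quiver.{w} D]

open Quiver

section Paths

variable {lev : D → ℤ} (hlev : ∀ {a b : D}, (a ⟶ b) → lev b = lev a + 1)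

include hlev

theorem level_path {a b : D} (p : Path a b) : lev b = lev a + p.length := by
  induction p with
  | nil => simp
  | cons p e ih => rw [hlev e, ih, Path.length_cons]; push_cast; ring

theorem eq_of_level_eq {a b : D} (p : Path a b) (h : lev a = lev b) : a = b :=
  p.eq_of_length_zero (by have := level_path hlev p; omega)

theorem eq_nil {a : D} (p : Path a a) : p = Path.nil :=
  p.eq_nil_of_length_zero (by have := level_path hlev p; omega)

theorem exists_split {a b : D} (p : Path a b) {t : ℤ} (h₁ : lev a ≤ t) (h₂ : t ≤ lev b) :
    ∃ (c : D) (p₁ : Path a c) (p₂ : Path c b), lev c = t ∧ p = p₁.comp p₂ := by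
  have := level_path hlev p
  obtain ⟨c, p₁, p₂, hp, hl⟩ := p.exists_eq_comp_of_le_length (n := (t - lev a).toNat) (by omega)
  have := level_path hlev p₁
  exact ⟨c, p₁, p₂, by omega, hp⟩

/-- Each arrow climbs one level, so a path meets every level between its ends in exactly one vertex
and the cut there is forced. The induction strips the last arrows of `p₂` and `p₂'` together. -/
theorem split_unique {a b c c' : D} {p₁ : Path a c} {p₂ : Path c b} {p₁' : Path a c'}
    {p₂' : Path c' b} (hc : lev c = lev c') (h : p₁.comp p₂ = p₁'.comp p₂') :
    ∃ e : c = c', e ▸ p₁ = p₁' ∧ e ▸ p₂ = p₂' := by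
  induction p₂ with
  | nil =>
    obtain rfl := eq_of_level_eq hlev p₂' hc.symm
    obtain rfl := eq_nil hlev p₂'
    exact ⟨rfl, h, rfl⟩
  | cons p₂ e ih =>
    cases p₂' with
    | nil =>
      have h₁ := level_path hlev (p₂.cons e)
      rw [Path.length_cons] at h₁
      omega
    | cons p₂' e' =>
      rw [Path.comp_cons, Path.comp_cons] at h
      obtain rfl := Path.obj_eq_of_cons_eq_cons h
      obtain ⟨rfl, h₁, h₂⟩ := ih (eq_of_heq (Path.heq_of_cons_eq_cons h))
      have h₃ := eq_of_heq (Path.hom_heq_of_cons_eq_cons h)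
      exact ⟨rfl, h₁, by subst h₂ h₃; rfl⟩

/-- This finiteness lets `eventually_of_level` replace bounds that depend on a path by their
maximum. -/
theorem finite_paths_to_level [∀ a : D, Finite (Σ b : D, a ⟶ b)] (a : D) (t : ℤ) :
    Finite {x : Σ b : D, Path a b // lev x.1 = t} := by
  have key : ∀ n : ℕ, Finite {x : Σ b : D, Path a b // lev x.1 = lev a + n} := by
    intro n
    induction n with
    | zero =>
      have : Subsingleton {x : Σ b : D, Path a b // lev x.1 = lev a + (0 : ℕ)} := by
        have : ∀ x : {x : Σ b : D, Path a b // lev x.1 = lev a + (0 : ℕ)},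
            x.1 = ⟨a, Path.nil⟩ := by
          rintro ⟨⟨b, p⟩, h⟩
          obtain rfl := eq_of_level_eq hlev p (by simpa using h.symm)
          obtain rfl := eq_nil hlev p
          rfl
        exact ⟨fun x y => Subtype.ext ((this x).trans (this y).symm)⟩
      infer_instance
    | succ n ih =>
      let f : (Σ x : {x : Σ b : D, Path a b // lev x.1 = lev a + n}, Σ c : D, x.1.1 ⟶ c) →
          {x : Σ b : D, Path a b // lev x.1 = lev a + (n + 1 : ℕ)} := fun y =>
        ⟨⟨y.2.1, y.1.1.2.cons y.2.2⟩, by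
          have := hlev y.2.2
          rw [y.1.2] at this
          push_cast
          omega⟩
      refine Finite.of_surjective f ?_
      rintro ⟨⟨b, p⟩, h⟩
      cases p with
      | nil => simp at h; omega
      | cons p e =>
        have := hlev e
        exact ⟨⟨⟨⟨_, p⟩, by simp only at h ⊢; push_cast at h; omega⟩, ⟨_, e⟩⟩, rfl⟩
  by_cases ht : lev a ≤ t
  · obtain ⟨n, rfl⟩ : ∃ n : ℕ, t = lev a + n := ⟨(t - lev a).toNat, by omega⟩
    exact key n
  · have : IsEmpty {x : Σ b : D, Path a b // lev x.1 = t} :=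
      ⟨fun x => ht (by have := level_path hlev x.1.2; have := x.2; omega)⟩
    infer_instance

end Paths

/-- Countability makes the path categories small relative to the universe of `k`, as the Kan
extensions into `ModuleCat.{u} k` require. -/
theorem countable_path [Countable D] [∀ a b : D, Countable (a ⟶ b)] (a b : D) :
    Countable (Path a b) := by
  have key : ∀ (n : ℕ) (b : D), Countable {p : Path a b // p.length = n} := by
    intro n
    induction n with
    | zero =>
      intro b
      have : Subsingleton {p : Path a b // p.length = 0} := by
        refine ⟨?_⟩
        rintro ⟨p, hp⟩ ⟨q, hq⟩
        obtain rfl := p.eq_of_length_zero hp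
        exact Subtype.ext ((p.eq_nil_of_length_zero hp).trans (q.eq_nil_of_length_zero hq).symm)
      infer_instance
    | succ n ih =>
      intro b
      let f : (Σ c : D, {p : Path a c // p.length = n} × (c ⟶ b)) →
          {p : Path a b // p.length = n + 1} := fun y =>
        ⟨y.2.1.1.cons y.2.2, by rw [Path.length_cons, y.2.1.2]⟩
      refine Function.Surjective.countable (f := f) ?_
      rintro ⟨p, h⟩
      cases p with
      | nil => simp at h
      | cons p e => exact ⟨⟨_, ⟨p, by simpa using h⟩, e⟩, rfl⟩
  have : ∀ n, Countable {p : Path a b // p.length = n} := fun n => key n b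
  exact Function.Surjective.countable
    (f := fun y : (Σ n : ℕ, {p : Path a b // p.length = n}) => y.2.1)
    fun p => ⟨⟨_, p, rfl⟩, rfl⟩

end LevelQuiver

/-! ### Morphisms that are invertible modulo torsion, and their restrictions -/

namespace LevelQuiver
open Quiver

variable (k : Type u) [Field k] {D : Type v} [Quiver.{w} D]

/-- The morphisms of representations of a levelled quiver whose kernel and cokernel are locally
annihilated by the paths that end at sufficiently high levels. -/
def torsionIso (lev : D → ℤ) : MorphismProperty (Paths D ⥤ ModuleCat.{u} k) := fun X Y f =>
  ∀ c : Paths D,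
    (∀ x : X.obj c, f.app c x = 0 →
      ∃ N : ℤ, ∀ (d : Paths D) (g : c ⟶ d), N ≤ lev d → X.map g x = 0) ∧
    ∀ y : Y.obj c, ∃ N : ℤ, ∀ (d : Paths D) (g : c ⟶ d), N ≤ lev d →
      ∃ x, f.app d x = Y.map g y

theorem torsionIso_of_isIso (lev : D → ℤ) {X Y : Paths D ⥤ ModuleCat.{u} k} (f : X ⟶ Y)
    [IsIso f] : torsionIso k lev f := by
  refine fun c => ⟨fun x hx => ⟨0, fun d g _ => ?_⟩, fun y => ⟨0, fun d g _ =>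
    ⟨(inv f).app d (Y.map g y), ?_⟩⟩⟩
  · have h : (inv f).app c (f.app c x) = x := by
      rw [← ModuleCat.comp_apply, ← NatTrans.comp_app, IsIso.hom_inv_id]; rfl
    rw [← h, hx, map_zero, map_zero]
  · rw [← ModuleCat.comp_apply, ← NatTrans.comp_app, IsIso.inv_hom_id]; rfl

instance (lev : D → ℤ) : (torsionIso k lev).RespectsIso := by
  refine MorphismProperty.RespectsIso.mk _ ?_ ?_
  · intro X Y Z e f hf c
    refine ⟨fun x hx => ?_, fun z => ?_⟩
    · obtain ⟨N, hN⟩ := (hf c).1 (e.hom.app c x) hx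
      refine ⟨N, fun d g hd => ?_⟩
      have h := hN d g hd
      rw [← NatTrans.naturality_apply] at h
      have h' : e.inv.app d (e.hom.app d (X.map g x)) = X.map g x := by
        rw [← ModuleCat.comp_apply, ← NatTrans.comp_app, Iso.hom_inv_id]; rfl
      rw [← h', h, map_zero]
    · obtain ⟨N, hN⟩ := (hf c).2 z
      refine ⟨N, fun d g hd => ?_⟩
      obtain ⟨y, hy⟩ := hN d g hd
      refine ⟨e.inv.app d y, ?_⟩
      rw [← hy, ← ModuleCat.comp_apply, ← NatTrans.comp_app, Iso.inv_hom_id_assoc]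
  · intro X Y Z e f hf c
    refine ⟨fun x hx => ?_, fun z => ?_⟩
    · refine (hf c).1 x ?_
      have h' : e.inv.app c (e.hom.app c (f.app c x)) = f.app c x := by
        rw [← ModuleCat.comp_apply, ← NatTrans.comp_app, Iso.hom_inv_id]; rfl
      have hx' : e.hom.app c (f.app c x) = 0 := hx
      rw [← h', hx', map_zero]
    · obtain ⟨N, hN⟩ := (hf c).2 (e.inv.app c z)
      refine ⟨N, fun d g hd => ?_⟩
      obtain ⟨x, hx⟩ := hN d g hd
      refine ⟨x, ?_⟩
      have hx' : e.hom.app d (f.app d x) = (f ≫ e.hom).app d x := rfl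
      rw [← hx', hx, ← NatTrans.naturality_apply e.inv, ← ModuleCat.comp_apply, ← NatTrans.comp_app,
        Iso.inv_hom_id]
      rfl

section Telescope

variable {lev : D → ℤ} (hlev : ∀ {a b : D}, (a ⟶ b) → lev b = lev a + 1)

include hlev in
-- A path to a level at least `t` factors through one of the finitely many paths from `c` to level
-- `t`, and the bounds attached to these have a common upper bound.
theorem eventually_of_level [∀ a : D, Finite (Σ b : D, a ⟶ b)] {c : Paths D} {t : ℤ}
    (ht : lev c ≤ t) (P : ∀ d : Paths D, (c ⟶ d) → Prop)
    (h : ∀ (d : Paths D) (g : c ⟶ d), lev d = t →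
      ∃ N : ℤ, ∀ (e : Paths D) (g' : d ⟶ e), N ≤ lev e → P e (g ≫ g')) :
    ∃ N : ℤ, ∀ (d : Paths D) (g : c ⟶ d), N ≤ lev d → P d g := by
  have := finite_paths_to_level hlev (show D from c) t
  choose! N hN using h
  obtain ⟨M, hM⟩ := (Set.finite_range fun x : {x : Σ b : D, Path (show D from c) b // lev x.1 = t} =>
    N x.1.1 x.1.2).bddAbove
  refine ⟨max M t, fun d g hd => ?_⟩
  obtain ⟨e, p, q, he, hp⟩ := exists_split hlev (show Path (show D from c) d from g) ht
    ((le_max_right _ _).trans hd)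
  have h₁ := hN e p he d q ((hM ⟨⟨⟨e, p⟩, he⟩, rfl⟩).trans ((le_max_left _ _).trans hd))
  have h₂ : g = (show c ⟶ (show Paths D from e) from p) ≫ (show (show Paths D from e) ⟶ d from q) :=
    hp
  rw [h₂]
  exact h₁

variable {K : Type v'} [Quiver.{w'} K] {lev' : K → ℤ} (ι : Paths K ⥤ Paths D) {l r : ℤ}
  (hl : 0 < l) (hι : ∀ x : Paths K, lev (ι.obj x) = l * lev' x + r)
  (hsurj : ∀ (d : Paths D) (s : ℤ), lev d = l * s + r → ∃ x, ι.obj x = d)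

include hlev hl hι hsurj in
-- Restriction only rescales the bounds. For the converse, the vertices on levels `l * s + r` come
-- from `K`, and the paths between them come from `K` by fullness. A high path is cut at two such
-- levels: one above `c`, where the hypothesis on `K` is applied, and one beyond the bound that it
-- supplies.
theorem torsionIso_iff_restrict [∀ a : D, Finite (Σ b : D, a ⟶ b)] [ι.Full]
    {X Y : Paths D ⥤ ModuleCat.{u} k} (f : X ⟶ Y) :
    torsionIso k lev f ↔
      torsionIso k lev' (((Functor.whiskeringLeft _ _ _).obj ι).map f) := by
  constructor
  · intro hf c
    -- For `s ≥ 0` and `l ≥ 1` one has `l * s + r ≥ s + r`, whence the bound `max 0 (N - r)`, here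
    -- and in `large` below.
    have key : ∀ (N : ℤ) (d : Paths K), max 0 (N - r) ≤ lev' d → N ≤ lev (ι.obj d) := by
      intro N d hd
      rw [hι]
      have h₀ := (le_max_left _ _).trans hd
      have h₁ := (le_max_right _ _).trans hd
      nlinarith
    refine ⟨fun x hx => ?_, fun y => ?_⟩
    · obtain ⟨N, hN⟩ := (hf (ι.obj c)).1 x hx
      exact ⟨max 0 (N - r), fun d g hd => hN _ (ι.map g) (key N d hd)⟩
    · obtain ⟨N, hN⟩ := (hf (ι.obj c)).2 y
      exact ⟨max 0 (N - r), fun d g hd => hN _ (ι.map g) (key N d hd)⟩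
  · intro hf c
    have large : ∀ M N : ℤ, ∃ s : ℤ, M ≤ s ∧ N ≤ l * s + r := fun M N => by
      refine ⟨max 0 (max M (N - r)), by simp, ?_⟩
      have h₀ : 0 ≤ max 0 (max M (N - r)) := le_max_left _ _
      have h₁ : N - r ≤ max 0 (max M (N - r)) := (le_max_right _ _).trans (le_max_right _ _)
      nlinarith
    -- A property that persists when a path is prolonged need only be checked on paths to one level
    -- coming from `K`, chosen beyond the bound.
    have key : ∀ (x : Paths K) (P : ∀ d : Paths D, (ι.obj x ⟶ d) → Prop)
        (_ : ∀ (d e : Paths D) (g : ι.obj x ⟶ d) (h : d ⟶ e), P d g → P e (g ≫ h))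
        (_ : ∃ N : ℤ, ∀ (y : Paths K) (g : x ⟶ y), N ≤ lev' y → P _ (ι.map g)),
        ∃ N : ℤ, ∀ (d : Paths D) (g : ι.obj x ⟶ d), N ≤ lev d → P d g := by
      rintro x P hP ⟨N, hN⟩
      obtain ⟨s, hs, hst⟩ := large N (lev (ι.obj x))
      refine eventually_of_level hlev hst P fun d g hd => ⟨0, fun e h _ => hP _ _ _ _ ?_⟩
      obtain ⟨y, rfl⟩ := hsurj d s hd
      obtain ⟨g, rfl⟩ := ι.map_surjective g
      refine hN y g ?_
      rw [hι] at hd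
      have : lev' y = s := mul_left_cancel₀ hl.ne' (by linarith)
      omega
    obtain ⟨s, -, hst⟩ := large 0 (lev c)
    refine ⟨fun x hx => ?_, fun y => ?_⟩
    · refine eventually_of_level hlev hst (fun d g => X.map g x = 0) fun d g hd => ?_
      obtain ⟨z, rfl⟩ := hsurj d s hd
      refine key z _ (fun d e g' h hg => ?_) ?_
      · rw [← Category.assoc, X.map_comp, ModuleCat.comp_apply, hg, map_zero]
      · obtain ⟨N, hN⟩ := (hf z).1 (X.map g x) (by
          have h₁ : f.app (ι.obj z) (X.map g x) = 0 := by
            rw [NatTrans.naturality_apply, hx, map_zero]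
          exact h₁)
        refine ⟨N, fun y g' hy => ?_⟩
        rw [X.map_comp, ModuleCat.comp_apply]
        exact hN y g' hy
    · refine eventually_of_level hlev hst (fun d g => ∃ x, f.app d x = Y.map g y)
        fun d g hd => ?_
      obtain ⟨z, rfl⟩ := hsurj d s hd
      refine key z _ (fun d e g' h hg => ?_) ?_
      · obtain ⟨x, hx⟩ := hg
        refine ⟨X.map h x, ?_⟩
        rw [← Category.assoc, Y.map_comp, ModuleCat.comp_apply, ← hx, NatTrans.naturality_apply]
      · obtain ⟨N, hN⟩ := (hf z).2 (Y.map g y)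
        refine ⟨N, fun y' g' hy => ?_⟩
        rw [Y.map_comp, ModuleCat.comp_apply]
        exact hN y' g' hy

include hlev hl hι hsurj in
-- Left Kan extension along `ι` is left adjoint to restriction, and its unit is invertible because
-- `ι` is fully faithful. The colimits that define it exist by smallness.
theorem nonempty_localization_equivalence [∀ a : D, Finite (Σ b : D, a ⟶ b)] [Countable D]
    [∀ a b : D, Countable (a ⟶ b)] [Countable K] [∀ a b : K, Countable (a ⟶ b)]
    [ι.Full] [ι.Faithful] :
    Nonempty ((torsionIso k lev).Localization ≌ (torsionIso k lev').Localization) := by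
  have hD : LocallySmall.{u} (Paths D) := ⟨fun a b => by
    have : Countable (a ⟶ b) := countable_path (D := D) a b
    infer_instance⟩
  have hK : LocallySmall.{u} (Paths K) := ⟨fun a b => by
    have : Countable (a ⟶ b) := countable_path (D := K) a b
    infer_instance⟩
  have hK' : Small.{u} (Paths K) := by
    have : Countable (Paths K) := ‹Countable K›
    infer_instance
  have hcolim (d : Paths D) :
      Limits.HasColimitsOfShape (CostructuredArrow ι d) (ModuleCat.{u} k) :=
    Limits.hasColimitsOfShape_of_essentiallySmall.{u} _ _
  have (F : Paths K ⥤ ModuleCat.{u} k) : ι.HasPointwiseLeftKanExtension F :=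
    fun d => inferInstanceAs (Limits.HasColimit _)
  exact localization_equivalence_of_adjunction (ι.lanAdjunction (ModuleCat.{u} k)) _ _
    (fun X Y f => torsionIso_iff_restrict k hlev ι hl hι hsurj f)
    (fun X Y f _ => torsionIso_of_isIso k lev' f)

end Telescope

end LevelQuiver

/-! ### Telescoping a levelled quiver -/

namespace LevelQuiver
open Quiver

variable {D : Type v} [Quiver.{w} D] {K : Type v'} [Quiver.{w'} K]

section Lift

variable {lev : D → ℤ} (hlev : ∀ {a b : D}, (a ⟶ b) → lev b = lev a + 1)
  {lev' : K → ℤ} (hlev' : ∀ {a b : K}, (a ⟶ b) → lev' b = lev' a + 1)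
  (φ : K ⥤q Paths D) {l r : ℤ} (hl : 0 < l)
  (hφ : ∀ x : K, lev (φ.obj x) = l * lev' x + r)
  (hinj : Function.Injective φ.obj)
  (hbij : ∀ x y : K, lev' y = lev' x + 1 →
    Function.Bijective (φ.map : (x ⟶ y) → (φ.obj x ⟶ φ.obj y)))

include hlev hφ hinj hbij

include hlev' in
-- The last arrow of a path in `K` is recovered by `split_unique` as the segment of the image
-- between the last two kept levels.
theorem lift_injective {x y : K} (p q : Path x y)
    (h : (Paths.lift φ).map (X := x) (Y := y) p = (Paths.lift φ).map (X := x) (Y := y) q) :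
    p = q := by
  induction p with
  | nil => exact (eq_nil hlev' q).symm
  | @cons b c p e ih =>
    cases q with
    | nil =>
      have h₁ := level_path hlev' (p.cons e)
      rw [Path.length_cons] at h₁
      omega
    | @cons b' _ q e' =>
      rw [Paths.lift_cons, Paths.lift_cons] at h
      have hb : lev (φ.obj b) = lev (φ.obj b') := by
        have h₁ := hlev' e
        have h₂ := hlev' e'
        have h₃ : lev' b = lev' b' := by omega
        rw [hφ, hφ, h₃]
      obtain ⟨he, h₁, h₂⟩ := split_unique (D := D) hlev hb h
      obtain rfl := hinj he
      rw [ih q h₁, (hbij b c (hlev' e)).1 h₂]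

variable (hsurj : ∀ (d : Paths D) (s : ℤ), lev d = l * s + r → ∃ x, φ.obj x = d)

include hl hsurj in
-- Cut at the last kept level before the end: `hsurj` places the vertex in `K`, `hbij` lifts the
-- final segment, and induction on the level difference lifts the rest.
theorem lift_surjective {x y : K} (p : φ.obj x ⟶ φ.obj y) :
    ∃ q : Path x y, (Paths.lift φ).map (X := x) (Y := y) q = p := by
  have hxy : lev' x ≤ lev' y := by
    have h := level_path hlev (show Path (show D from φ.obj x) (φ.obj y) from p)
    rw [hφ, hφ] at h
    exact le_of_mul_le_mul_left (by omega) hl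
  obtain ⟨n, hn⟩ : ∃ n : ℕ, lev' y = lev' x + n := ⟨(lev' y - lev' x).toNat, by omega⟩
  clear hxy
  induction n generalizing y with
  | zero =>
    obtain rfl : x = y := hinj (eq_of_level_eq (D := D) hlev p (by rw [hφ, hφ, hn]; simp))
    exact ⟨Path.nil, (eq_nil (D := D) hlev p).symm⟩
  | succ n ih =>
    push_cast at hn
    obtain ⟨c, p₁, p₂, hc, hp⟩ := exists_split (D := D) hlev p (t := l * (lev' x + n) + r)
      (by rw [hφ]; nlinarith) (by rw [hφ, hn]; nlinarith)
    obtain ⟨z, rfl⟩ := hsurj c _ hc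
    have hz : lev' z = lev' x + n := by
      rw [hφ] at hc
      exact mul_left_cancel₀ hl.ne' (by linarith)
    obtain ⟨q₁, hq₁⟩ := ih p₁ hz
    obtain ⟨e, he⟩ := (hbij z y (by omega)).2 p₂
    refine ⟨q₁.cons e, ?_⟩
    rw [Paths.lift_cons, hq₁, he]
    exact hp.symm

end Lift

/-- Telescoping: if the vertices of `K` are the vertices of `D` on every `l`-th level, and the
arrows of `K` between consecutive levels correspond to the paths of `D`, then `K` and `D` have
equivalent categories of representations modulo torsion. -/
theorem telescope (k : Type u) [Field k] [∀ a : D, Finite (Σ b : D, a ⟶ b)] [Countable D]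
    [∀ a b : D, Countable (a ⟶ b)] [Countable K] [∀ a b : K, Countable (a ⟶ b)]
    {lev : D → ℤ} (hlev : ∀ {a b : D}, (a ⟶ b) → lev b = lev a + 1)
    {lev' : K → ℤ} (hlev' : ∀ {a b : K}, (a ⟶ b) → lev' b = lev' a + 1)
    (o : K → D) {l r : ℤ} (hl : 0 < l) (ho : ∀ x : K, lev (o x) = l * lev' x + r)
    (hinj : Function.Injective o)
    (hsurj : ∀ (d : D) (s : ℤ), lev d = l * s + r → ∃ x, o x = d)
    (hpath : ∀ x y : K, lev' y = lev' x + 1 → Nonempty ((x ⟶ y) ≃ Path (o x) (o y))) :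
    Nonempty ((torsionIso k lev).Localization ≌ (torsionIso k lev').Localization) := by
  -- Path categories are free, so arbitrary choices of the bijections, with no compatibility between
  -- them, define a functor.
  let φ : K ⥤q Paths D :=
    { obj := o
      map := fun {x y} e => (hpath x y (hlev' e)).some e }
  have hbij : ∀ x y : K, lev' y = lev' x + 1 →
      Function.Bijective (φ.map : (x ⟶ y) → (φ.obj x ⟶ φ.obj y)) :=
    fun x y h => (hpath x y h).some.bijective
  have : (Paths.lift φ).Faithful := ⟨fun {x y p q} h =>
    lift_injective hlev hlev' φ ho hinj hbij p q h⟩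
  have : (Paths.lift φ).Full := ⟨fun {x y} p =>
    lift_surjective hlev φ hl ho hinj hbij hsurj p⟩
  exact nonempty_localization_equivalence k hlev (Paths.lift φ) hl ho hsurj

/-- A path of positive length is a path followed by an arrow. -/
def pathEquivOfNe {a b : D} (h : a ≠ b) : Path a b ≃ Σ c : D, Path a c × (c ⟶ b) where
  toFun p := match p, h with
    | Path.nil, h => (h rfl).elim
    | Path.cons p e, _ => ⟨_, p, e⟩
  invFun x := x.2.1.cons x.2.2
  left_inv p := by
    cases p with
    | nil => exact (h rfl).elim
    | cons p e => rfl
  right_inv x := rfl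

/-- The number of paths between two vertices, in terms of the vertices before the last one. -/
theorem nonempty_path_equiv_of_last {a b : D} (hab : a ≠ b) {J : Type*} [Fintype J] (mid : J → D)
    (hinj : Function.Injective mid) (hmid : ∀ c : D, (c ⟶ b) → ∃ j, mid j = c) {p q : J → ℕ}
    (hp : ∀ j, Nonempty (Path a (mid j) ≃ Fin (p j))) (hq : ∀ j, Nonempty ((mid j ⟶ b) ≃ Fin (q j))) :
    Nonempty (Path a b ≃ Fin (∑ j, q j * p j)) := by
  let f : (Σ j : J, Path a (mid j) × (mid j ⟶ b)) → Σ c : D, Path a c × (c ⟶ b) :=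
    fun x => ⟨mid x.1, x.2⟩
  have hf : Function.Bijective f := by
    refine ⟨?_, ?_⟩
    · rintro ⟨j, x⟩ ⟨j', x'⟩ h
      obtain rfl := hinj (congrArg Sigma.fst h)
      simpa [f] using h
    · rintro ⟨c, x⟩
      obtain ⟨j, rfl⟩ := hmid c x.2
      exact ⟨⟨j, x⟩, rfl⟩
  refine ⟨(pathEquivOfNe hab).trans ((Equiv.ofBijective f hf).symm.trans
    ((Equiv.sigmaCongrRight fun j => (hp j).some.prodCongr (hq j).some).trans
      (Fintype.equivFinOfCardEq ?_)))⟩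
  simp only [Fintype.card_sigma, Fintype.card_prod, Fintype.card_fin]
  exact Finset.sum_congr rfl fun v _ => mul_comm _ _

/-- A path between consecutive levels is an arrow. -/
noncomputable def pathLevelSuccEquiv {lev : D → ℤ}
    (hlev : ∀ {a b : D}, (a ⟶ b) → lev b = lev a + 1) {a b : D} (h : lev b = lev a + 1) :
    Path a b ≃ (a ⟶ b) := by
  refine Equiv.symm (Equiv.ofBijective (fun e => e.toPath) ⟨fun e e' h => ?_, fun p => ?_⟩)
  · exact eq_of_heq (Path.hom_heq_of_cons_eq_cons h)
  · have := level_path hlev p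
    cases p with
    | nil => omega
    | cons p e =>
      have := hlev e
      obtain rfl := eq_of_level_eq hlev p (by omega)
      obtain rfl := eq_nil hlev p
      exact ⟨e, rfl⟩

/-- The path of length zero is the only path between equal levels. -/
theorem nonempty_path_equiv_of_level_eq {lev : D → ℤ}
    (hlev : ∀ {a b : D}, (a ⟶ b) → lev b = lev a + 1) {a b : D} [Decidable (b = a)] (h : lev a = lev b) :
    Nonempty (Path a b ≃ Fin (if b = a then 1 else 0)) := by
  split_ifs with hab
  · subst hab
    exact ⟨⟨fun _ => 0, fun _ => Path.nil, fun p => (eq_nil hlev p).symm,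
      fun x => Subsingleton.elim _ _⟩⟩
  · have : IsEmpty (Path a b) := ⟨fun p => hab (eq_of_level_eq hlev p h).symm⟩
    exact ⟨Equiv.equivOfIsEmpty _ _⟩

end LevelQuiver

/-! ### The covering quiver and powers of the incidence matrix -/

open Quiver

/-- The covering of a quiver `V` by its `ℤ`-graded copies: the vertices are pairs `(i, n)`, and an
arrow from `i` to `j` gives an arrow from `(i, n)` to `(j, n + 1)` for every `n`. -/
@[ext]
structure LevelCover (V : Type v) where
  /-- the underlying vertex -/
  vertex : V
  /-- the level -/
  level : ℤ

namespace LevelCover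

variable {V : Type v}

instance [Finite V] : Countable (LevelCover V) :=
  Function.Injective.countable (f := fun c : LevelCover V => (c.vertex, c.level)) fun _ _ h =>
    LevelCover.ext (congrArg Prod.fst h) (congrArg Prod.snd h)

variable [Quiver.{w} V]

instance : Quiver.{w} (LevelCover V) :=
  ⟨fun c d => {_a : c.vertex ⟶ d.vertex // d.level = c.level + 1}⟩

theorem level_eq {c d : LevelCover V} (a : c ⟶ d) : d.level = c.level + 1 := a.2

instance [∀ i j : V, Finite (i ⟶ j)] (c d : LevelCover V) : Finite (c ⟶ d) :=
  inferInstanceAs (Finite {_a : c.vertex ⟶ d.vertex // d.level = c.level + 1})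

instance [Finite V] [∀ i j : V, Finite (i ⟶ j)] (c : LevelCover V) :
    Finite (Σ d : LevelCover V, c ⟶ d) := by
  refine Finite.of_surjective (α := Σ j : V, c.vertex ⟶ j)
    (fun x => ⟨⟨x.1, c.level + 1⟩, ⟨x.2, rfl⟩⟩) ?_
  rintro ⟨⟨j, n⟩, ⟨a, ha⟩⟩
  obtain rfl : n = c.level + 1 := ha
  exact ⟨⟨j, a⟩, rfl⟩

/-- The induction removes the last arrow. Since the `(j, v)` entry counts the arrows from `v` to
`j`, that arrow is the left factor in `A ^ (n + 1) = A * A ^ n`. -/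
theorem nonempty_path_equiv [Fintype V] [DecidableEq V] [∀ i j : V, Fintype (i ⟶ j)] (i j : V)
    (m : ℤ) (n : ℕ) :
    Nonempty (Path (⟨i, m⟩ : LevelCover V) ⟨j, m + n⟩ ≃ Fin ((incidenceMatrix V ^ n) j i)) := by
  classical
  induction n generalizing j with
  | zero =>
    obtain ⟨e⟩ := LevelQuiver.nonempty_path_equiv_of_level_eq (D := LevelCover V)
      (lev := level) level_eq (a := ⟨i, m⟩) (b := ⟨j, m + (0 : ℕ)⟩) (by simp)
    refine ⟨e.trans (finCongr ?_)⟩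
    rw [pow_zero, Matrix.one_apply]
    simp
  | succ n ih =>
    have hne : (⟨i, m⟩ : LevelCover V) ≠ ⟨j, m + (n + 1 : ℕ)⟩ := fun h => by
      have := congrArg level h
      simp only at this
      omega
    rw [pow_succ', Matrix.mul_apply]
    refine LevelQuiver.nonempty_path_equiv_of_last hne (fun v : V => ⟨v, m + n⟩)
      (fun v v' h => congrArg vertex h) ?_ ih fun v => ?_
    · rintro ⟨v, s⟩ ⟨a, h⟩
      exact ⟨v, LevelCover.ext rfl (by simp only at h ⊢; push_cast at h; omega)⟩
    · exact ⟨(Equiv.subtypeUnivEquiv fun _ => by push_cast; ring).trans (Fintype.equivFin _)⟩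

end LevelCover

/-- The vertices of the quiver with a given incidence matrix. -/
def MatrixQuiver {V : Type v} (_M : Matrix V V ℕ) : Type v := V

namespace MatrixQuiver

variable {V : Type v} (M : Matrix V V ℕ)

instance : Quiver.{0} (MatrixQuiver M) := ⟨fun i j => Fin (M j i)⟩

instance [Fintype V] : Fintype (MatrixQuiver M) := inferInstanceAs (Fintype V)

instance (i j : MatrixQuiver M) : Fintype (i ⟶ j) := inferInstanceAs (Fintype (Fin (M j i)))

/-- Arrows between consecutive levels of the covering. -/
def homEquiv {i j : MatrixQuiver M} {m n : ℤ} (h : n = m + 1) :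
    ((⟨i, m⟩ : LevelCover (MatrixQuiver M)) ⟶ ⟨j, n⟩) ≃ Fin (M j i) where
  toFun a := a.1
  invFun a := ⟨a, h⟩
  left_inv _ := rfl
  right_inv _ := rfl

end MatrixQuiver

/-- Passing to the paths of length `l` does not change the representations modulo torsion. -/
theorem LevelCover.nonempty_equivalence_pow (k : Type u) [Field k] {V : Type v} [Quiver.{w} V]
    [Fintype V] [DecidableEq V] [∀ i j : V, Fintype (i ⟶ j)] {l : ℕ} (hl : 0 < l) :
    Nonempty ((LevelQuiver.torsionIso k (level : LevelCover V → ℤ)).Localization ≌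
      (LevelQuiver.torsionIso k
        (level : LevelCover (MatrixQuiver (incidenceMatrix V ^ l)) → ℤ)).Localization) := by
  -- Level `n` of the cover of the power is level `l * n` of the cover of `V`.
  refine LevelQuiver.telescope k level_eq level_eq (fun x => ⟨x.vertex, l * x.level⟩)
    (l := l) (r := 0) (by exact_mod_cast hl) (fun x => by simp) ?_ ?_ ?_
  · rintro ⟨i, m⟩ ⟨j, n⟩ h
    exact LevelCover.ext (congrArg vertex h :)
      (mul_left_cancel₀ (by exact_mod_cast hl.ne') (congrArg level h :))
  · rintro ⟨i, m⟩ s h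
    exact ⟨⟨i, s⟩, LevelCover.ext rfl (by simp_all)⟩
  · rintro ⟨i, m⟩ ⟨j, n⟩ h
    obtain rfl : n = m + 1 := h
    obtain ⟨e⟩ := LevelCover.nonempty_path_equiv (V := V) i j (l * m) l
    refine ⟨(MatrixQuiver.homEquiv _ rfl).trans (e.symm.trans (Equiv.cast ?_))⟩
    simp only
    rw [mul_add, mul_one]

/-! ### The alternating quiver of a factorization -/

/-- The levelled quiver in which the vertices of two sets alternate, with arrows from the first to
the second counted by `R` and arrows from the second to the first counted by `L`. -/
inductive AlternatingQuiver {V : Type v} {V' : Type v'} (_L : Matrix V V' ℕ) (_R : Matrix V' V ℕ) :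
    Type max v v'
  | left (i : V) (n : ℤ) : AlternatingQuiver _L _R
  | right (j : V') (n : ℤ) : AlternatingQuiver _L _R

namespace AlternatingQuiver

variable {V : Type v} {V' : Type v'} {L : Matrix V V' ℕ} {R : Matrix V' V ℕ}

/-- The level of a vertex. -/
def level : AlternatingQuiver L R → ℤ
  | left _ n => 2 * n
  | right _ n => 2 * n + 1

instance [Finite V] [Finite V'] : Countable (AlternatingQuiver L R) := by
  refine Function.Surjective.countable
    (f := fun x : (V × ℤ) ⊕ (V' × ℤ) => match x with
      | .inl x => (left x.1 x.2 : AlternatingQuiver L R)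
      | .inr x => right x.1 x.2) ?_
  rintro (⟨i, n⟩ | ⟨j, n⟩)
  · exact ⟨.inl (i, n), rfl⟩
  · exact ⟨.inr (j, n), rfl⟩

/-- The arrows. -/
def Hom : AlternatingQuiver L R → AlternatingQuiver L R → Type
  | left i m, right j n => {_a : Fin (R j i) // n = m}
  | right j m, left i n => {_a : Fin (L i j) // n = m + 1}
  | left _ _, left _ _ => Empty
  | right _ _, right _ _ => Empty

instance : Quiver.{0} (AlternatingQuiver L R) := ⟨Hom⟩

instance (c d : AlternatingQuiver L R) : Finite (c ⟶ d) := by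
  rcases c with ⟨i, m⟩ | ⟨j, m⟩ <;> rcases d with ⟨i', n⟩ | ⟨j', n⟩
  · exact inferInstanceAs (Finite Empty)
  · exact inferInstanceAs (Finite {_a : Fin (R j' i) // n = m})
  · exact inferInstanceAs (Finite {_a : Fin (L i' j) // n = m + 1})
  · exact inferInstanceAs (Finite Empty)

theorem level_eq {c d : AlternatingQuiver L R} (a : c ⟶ d) : d.level = c.level + 1 := by
  rcases c with ⟨i, m⟩ | ⟨j, m⟩ <;> rcases d with ⟨i', n⟩ | ⟨j', n⟩
  · exact a.elim
  · obtain ⟨-, h⟩ := a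
    simp only [level, h]
  · obtain ⟨-, h⟩ := a
    simp only [level, h]
    ring
  · exact a.elim

instance [Finite V] [Finite V'] (c : AlternatingQuiver L R) :
    Finite (Σ d : AlternatingQuiver L R, c ⟶ d) := by
  rcases c with ⟨i, m⟩ | ⟨j, m⟩
  · refine Finite.of_surjective (α := Σ j : V', Fin (R j i))
      (fun x => ⟨right x.1 m, ⟨x.2, rfl⟩⟩) ?_
    rintro ⟨⟨i', n⟩ | ⟨j', n⟩, a⟩
    · exact a.elim
    · obtain ⟨a, rfl⟩ := a
      exact ⟨⟨j', a⟩, rfl⟩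
  · refine Finite.of_surjective (α := Σ i : V, Fin (L i j))
      (fun x => ⟨left x.1 (m + 1), ⟨x.2, rfl⟩⟩) ?_
    rintro ⟨⟨i', n⟩ | ⟨j', n⟩, a⟩
    · obtain ⟨a, rfl⟩ := a
      exact ⟨⟨i', a⟩, rfl⟩
    · exact a.elim

/-- The arrows from the left to the right. -/
def leftHomEquiv (i : V) (j : V') (n : ℤ) :
    ((left i n : AlternatingQuiver L R) ⟶ right j n) ≃ Fin (R j i) where
  toFun a := a.1
  invFun a := ⟨a, rfl⟩
  left_inv _ := rfl
  right_inv _ := rfl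

/-- The arrows from the right to the left. -/
def rightHomEquiv (i : V) (j : V') (n : ℤ) :
    ((right j n : AlternatingQuiver L R) ⟶ left i (n + 1)) ≃ Fin (L i j) where
  toFun a := a.1
  invFun a := ⟨a, rfl⟩
  left_inv _ := rfl
  right_inv _ := rfl

/-- Such a path has length two and passes through some `right j n`; summing over `j` gives the
matrix product. -/
theorem nonempty_path_left [Fintype V'] (i i' : V) (n : ℤ) :
    Nonempty (Path (left i n : AlternatingQuiver L R) (left i' (n + 1)) ≃
      Fin ((L * R) i' i)) := by
  rw [Matrix.mul_apply]
  refine LevelQuiver.nonempty_path_equiv_of_last (by simp) (fun j : V' => right j n)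
    (fun j j' h => by simpa using h) ?_
    (fun j => ⟨(LevelQuiver.pathLevelSuccEquiv level_eq rfl).trans (leftHomEquiv i j n)⟩)
    (fun j => ⟨rightHomEquiv i' j n⟩)
  rintro (⟨v, s⟩ | ⟨v, s⟩) a
  · exact a.elim
  · have h := a.2
    exact ⟨v, by rw [add_right_cancel h]⟩

theorem nonempty_path_right [Fintype V] (j j' : V') (n : ℤ) :
    Nonempty (Path (right j n : AlternatingQuiver L R) (right j' (n + 1)) ≃
      Fin ((R * L) j' j)) := by
  rw [Matrix.mul_apply]
  refine LevelQuiver.nonempty_path_equiv_of_last (by simp) (fun i : V => left i (n + 1))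
    (fun i i' h => by simpa using h) ?_
    (fun i => ⟨(LevelQuiver.pathLevelSuccEquiv level_eq (by simp only [level]; ring)).trans
      (rightHomEquiv i j n)⟩)
    (fun i => ⟨leftHomEquiv i j' (n + 1)⟩)
  rintro (⟨v, s⟩ | ⟨v, s⟩) a
  · exact ⟨v, by rw [a.2]⟩
  · exact a.elim

variable (L R)

theorem nonempty_equivalence_left (k : Type u) [Field k] [Fintype V] [Fintype V'] :
    Nonempty ((LevelQuiver.torsionIso k (level : AlternatingQuiver L R → ℤ)).Localization ≌
      (LevelQuiver.torsionIso k
        (LevelCover.level : LevelCover (MatrixQuiver (L * R)) → ℤ)).Localization) := by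
  refine LevelQuiver.telescope k level_eq LevelCover.level_eq (fun x => left x.vertex x.level)
    (l := 2) (r := 0) two_pos (fun x => by simp [level]) ?_ ?_ ?_
  · rintro ⟨i, m⟩ ⟨j, n⟩ h
    obtain ⟨rfl, rfl⟩ := left.inj h
    rfl
  · rintro (⟨i, m⟩ | ⟨j, m⟩) s h
    · obtain rfl : m = s := by simp only [level] at h; omega
      exact ⟨⟨i, m⟩, rfl⟩
    · simp only [level] at h
      omega
  · rintro ⟨i, m⟩ ⟨j, n⟩ h
    obtain rfl : n = m + 1 := h
    obtain ⟨e⟩ := nonempty_path_left (L := L) (R := R) i j m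
    exact ⟨(MatrixQuiver.homEquiv _ rfl).trans e.symm⟩

theorem nonempty_equivalence_right (k : Type u) [Field k] [Fintype V] [Fintype V'] :
    Nonempty ((LevelQuiver.torsionIso k (level : AlternatingQuiver L R → ℤ)).Localization ≌
      (LevelQuiver.torsionIso k
        (LevelCover.level : LevelCover (MatrixQuiver (R * L)) → ℤ)).Localization) := by
  refine LevelQuiver.telescope k level_eq LevelCover.level_eq (fun x => right x.vertex x.level)
    (l := 2) (r := 1) two_pos (fun x => by simp [level]) ?_ ?_ ?_
  · rintro ⟨i, m⟩ ⟨j, n⟩ h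
    obtain ⟨rfl, rfl⟩ := right.inj h
    rfl
  · rintro (⟨i, m⟩ | ⟨j, m⟩) s h
    · simp only [level] at h
      omega
    · obtain rfl : m = s := by simp only [level] at h; omega
      exact ⟨⟨j, m⟩, rfl⟩
  · rintro ⟨i, m⟩ ⟨j, n⟩ h
    obtain rfl : n = m + 1 := h
    obtain ⟨e⟩ := nonempty_path_right (L := L) (R := R) i j m
    exact ⟨(MatrixQuiver.homEquiv _ rfl).trans e.symm⟩

end AlternatingQuiver

/-- Shift equivalent incidence matrices give equivalent categories of representations of the
covering quivers modulo torsion. -/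
theorem ShiftEquivalent.nonempty_localization_equivalence (k : Type u) [Field k]
    {V : Type v} [Quiver.{w} V] [Fintype V] [DecidableEq V] [∀ i j : V, Fintype (i ⟶ j)]
    {V' : Type v'} [Quiver.{w'} V'] [Fintype V'] [DecidableEq V'] [∀ i j : V', Fintype (i ⟶ j)]
    (h : ShiftEquivalent (incidenceMatrix V) (incidenceMatrix V')) :
    Nonempty ((LevelQuiver.torsionIso k (LevelCover.level : LevelCover V → ℤ)).Localization ≌
      (LevelQuiver.torsionIso k (LevelCover.level : LevelCover V' → ℤ)).Localization) := by
  obtain ⟨l, L, R, hl, -, -, hA, hB⟩ := h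
  obtain ⟨e₁⟩ := LevelCover.nonempty_equivalence_pow k (V := V) hl
  obtain ⟨e₂⟩ := LevelCover.nonempty_equivalence_pow k (V := V') hl
  -- The telescoped cover depends only on the matrix, so the factorization can be substituted.
  rw [hA] at e₁
  rw [hB] at e₂
  obtain ⟨e₃⟩ := AlternatingQuiver.nonempty_equivalence_left L R k
  obtain ⟨e₄⟩ := AlternatingQuiver.nonempty_equivalence_right L R k
  exact ⟨e₁.trans (e₃.symm.trans (e₄.trans e₂.symm))⟩

/-! ### Graded modules as representations of the covering quiver -/

/-- A natural transformation between functors on a path category is determined by components that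
are natural with respect to the arrows. -/
def CategoryTheory.Paths.natTransOfArrows {D : Type*} [Quiver D] {C : Type*} [Category C]
    {X Y : Paths D ⥤ C} (app : ∀ c : Paths D, X.obj c ⟶ Y.obj c)
    (h : ∀ (c d : D) (a : c ⟶ d), X.map ((Paths.of D).map a) ≫ app ((Paths.of D).obj d) =
      app ((Paths.of D).obj c) ≫ Y.map ((Paths.of D).map a)) : X ⟶ Y where
  app := app
  naturality c d g := by
    induction g using Paths.induction_fixed_source with
    | id => rw [X.map_id, Y.map_id, Category.id_comp, Category.comp_id]
    | comp p q ih => rw [X.map_comp, Y.map_comp, Category.assoc, h, reassoc_of% ih]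

namespace GrMod

variable {k : Type u} [Field k] {V : Type v} [Quiver.{w} V] [Fintype V]

open PathAlgebra

/-- The idempotent of the path algebra at a vertex. -/
noncomputable abbrev idem (k : Type u) [Field k] {V : Type v} [Quiver.{w} V] (i : V) :
    PathAlgebra k V := ofPath k ⟨i, i, Path.nil⟩

theorem smul_base_comm (M : GrMod k V) (c : k) (a : PathAlgebra k V) (x : M) :
    a • c • x = c • a • x :=
  have := IsScalarTower.to_smulCommClass (R := k) (A := PathAlgebra k V) (M := M)
  (smul_comm c a x).symm

theorem cons_smul (M : GrMod k V) {i j l : V} (p : Path i j) (a : j ⟶ l) (x : M) :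
    ofPath k ⟨i, l, p.cons a⟩ • x = ofPath k ⟨j, l, a.toPath⟩ • ofPath k ⟨i, j, p⟩ • x := by
  rw [← mul_smul, ofPath_mul_of_eq]
  rfl

omit [Fintype V] in
theorem ofPath_mem_degree (p : QPath V) : ofPath k p ∈ degree k V p.path.length :=
  Submodule.subset_span ⟨p, rfl, rfl⟩

/-- The component of a graded module at a vertex of the covering quiver. -/
def component (M : GrMod k V) (c : LevelCover V) : Submodule k M where
  carrier := {x | x ∈ M.grading c.level ∧ idem k c.vertex • x = x}
  add_mem' hx hy := ⟨add_mem hx.1 hy.1, by rw [smul_add, hx.2, hy.2]⟩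
  zero_mem' := ⟨zero_mem _, smul_zero _⟩
  smul_mem' r x hx := ⟨Submodule.smul_mem _ _ hx.1, by rw [smul_base_comm, hx.2]⟩

theorem ofPath_smul_mem_component (M : GrMod k V) {i j : V} (p : Path i j) {n : ℤ} {x : M}
    (hx : x ∈ M.grading n) : ofPath k ⟨i, j, p⟩ • x ∈ M.component ⟨j, p.length + n⟩ :=
  ⟨M.smul_mem _ _ _ _ (ofPath_mem_degree ⟨i, j, p⟩) hx, by
    rw [← mul_smul, ofPath_mul_of_eq, Path.comp_nil]⟩

theorem ofPath_smul_of_ne (M : GrMod k V) (p : QPath V) {c : LevelCover V} {x : M}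
    (hx : x ∈ M.component c) (h : p.src ≠ c.vertex) : ofPath k p • x = 0 := by
  rw [← hx.2, ← mul_smul, ofPath_mul_of_ne _ _ h, zero_smul]

/-- The action of an arrow of the covering quiver on the components. -/
noncomputable def arrowMap (M : GrMod k V) {c d : LevelCover V} (a : c ⟶ d) :
    M.component c →ₗ[k] M.component d where
  toFun x := ⟨ofPath k ⟨c.vertex, d.vertex, a.1.toPath⟩ • (x : M), by
    have h := M.ofPath_smul_mem_component a.1.toPath x.2.1
    rw [Path.length_toPath, Nat.cast_one, add_comm] at h
    have e : d = ⟨d.vertex, c.level + 1⟩ := LevelCover.ext rfl a.2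
    exact (congrArg (fun d' => _ ∈ M.component d') e).mpr h⟩
  map_add' x y := Subtype.ext (smul_add _ _ _)
  map_smul' r x := Subtype.ext (M.smul_base_comm _ _ _)

/-- The projection of a graded module onto a component. -/
noncomputable def toComponent (M : GrMod k V) (c : LevelCover V) : M →ₗ[k] M.component c where
  toFun x := ⟨idem k c.vertex • M.proj c.level x, by
    simpa using M.ofPath_smul_mem_component (Path.nil (a := c.vertex)) (M.proj_mem c.level x)⟩
  map_add' x y := Subtype.ext (by simp)
  map_smul' r x := Subtype.ext (by simp [smul_base_comm])

theorem toComponent_of_mem (M : GrMod k V) {c : LevelCover V} {x : M} (hx : x ∈ M.component c) :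
    (M.toComponent c x : M) = x := by
  change idem k c.vertex • M.proj c.level x = x
  rw [M.proj_of_mem hx.1, hx.2]

theorem toComponent_of_mem_ne (M : GrMod k V) {c d : LevelCover V} (hcd : c ≠ d) {x : M}
    (hx : x ∈ M.component c) : M.toComponent d x = 0 := by
  refine Subtype.ext ?_
  change idem k d.vertex • M.proj d.level x = 0
  by_cases h : c.level = d.level
  · rw [← h, M.proj_of_mem hx.1]
    exact M.ofPath_smul_of_ne _ hx fun h' => hcd (LevelCover.ext h'.symm h)
  · rw [M.proj_of_mem_ne h hx.1, smul_zero]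

theorem sum_idem_smul (M : GrMod k V) (x : M) : ∑ i : V, idem k i • x = x := by
  rw [← Finset.sum_smul, ← one_def, one_smul]

theorem component_induction (M : GrMod k V) {P : M → Prop} (x : M) (zero : P 0)
    (add : ∀ x y, P x → P y → P (x + y)) (mem : ∀ c, ∀ x ∈ M.component c, P x) : P x := by
  classical
  induction x using M.induction_on with
  | zero => exact zero
  | add x y hx hy => exact add x y hx hy
  | mem n x hx =>
    rw [← M.sum_idem_smul x]
    refine Finset.sum_induction _ P add zero fun i _ => mem ⟨i, n⟩ _ ?_
    simpa using M.ofPath_smul_mem_component (Path.nil (a := i)) hx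

open Classical in
-- `toComponent` reads off the coordinates, which gives independence. The components span because
-- the vertex idempotents sum to `1`.
theorem component_isInternal (M : GrMod k V) : DirectSum.IsInternal M.component := by
  constructor
  · change Function.Injective (DirectSum.coeLinearMap M.component)
    rw [← LinearMap.ker_eq_bot, LinearMap.ker_eq_bot']
    intro t ht
    have key : ∀ (t : DirectSum (LevelCover V) fun c => M.component c) (c : LevelCover V),
        M.toComponent c (DirectSum.coeLinearMap M.component t) = t c := by
      intro t c
      induction t using DirectSum.induction_on with
      | zero => simp
      | add s t hs ht => rw [map_add, map_add, hs, ht]; rfl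
      | of d x =>
        erw [DirectSum.coeLinearMap_lof]
        by_cases h : d = c
        · subst h
          rw [DirectSum.of_eq_same]
          exact Subtype.ext (M.toComponent_of_mem x.2)
        · rw [M.toComponent_of_mem_ne h x.2, DirectSum.of_eq_of_ne _ _ _ (Ne.symm h)]
    refine DFinsupp.ext fun c => ?_
    rw [← key, ht, map_zero]
    rfl
  · intro x
    induction x using M.component_induction with
    | zero => exact ⟨0, map_zero _⟩
    | add x y hx hy =>
      obtain ⟨s, rfl⟩ := hx
      obtain ⟨t, rfl⟩ := hy
      exact ⟨s + t, map_add _ _ _⟩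
    | mem c x hx => exact ⟨DirectSum.of (fun c => M.component c) c ⟨x, hx⟩,
        DirectSum.coeAddMonoidHom_of _ _ _⟩

theorem map_mem_component {M N : GrMod k V} (f : M ⟶ N) {c : LevelCover V} {x : M}
    (hx : x ∈ M.component c) : f.toLinearMap x ∈ N.component c :=
  ⟨f.map_mem _ _ hx.1, by rw [← map_smul, hx.2]⟩

theorem map_base_smul {M N : GrMod k V} (f : M ⟶ N) (r : k) (x : M) :
    f.toLinearMap (r • x) = r • f.toLinearMap x := by
  rw [← one_smul (PathAlgebra k V) x, ← smul_assoc, map_smul, map_smul, smul_assoc]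

/-- The map on components induced by a morphism of graded modules. -/
noncomputable def componentMap {M N : GrMod k V} (f : M ⟶ N) (c : LevelCover V) :
    M.component c →ₗ[k] N.component c where
  toFun x := ⟨f.toLinearMap x, map_mem_component f x.2⟩
  map_add' _ _ := Subtype.ext (map_add _ _ _)
  map_smul' _ _ := Subtype.ext (map_base_smul f _ _)

theorem map_toComponent {M N : GrMod k V} (f : M ⟶ N) (c : LevelCover V) (x : M) :
    f.toLinearMap (M.toComponent c x) = N.toComponent c (f.toLinearMap x) := by
  change f.toLinearMap (idem k c.vertex • M.proj c.level x) =
    idem k c.vertex • N.proj c.level (f.toLinearMap x)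
  rw [map_smul, map_proj]

/-- The representation of the covering quiver given by a graded module. -/
noncomputable def toRep (M : GrMod k V) : Paths (LevelCover V) ⥤ ModuleCat.{u} k :=
  Paths.lift
    { obj := fun c => ModuleCat.of k (M.component c)
      map := fun a => ModuleCat.ofHom (M.arrowMap a) }

/-- The projection of the covering quiver. -/
def coverProj (V : Type v) [Quiver.{w} V] : LevelCover V ⥤q V where
  obj c := c.vertex
  map a := a.1

theorem toRep_map_coe (M : GrMod k V) {c d : LevelCover V} (p : Path c d) (x : M.component c) :
    Subtype.val (p := (· ∈ M.component d)) ((M.toRep.map (X := c) (Y := d) p).hom x) =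
      ofPath k ⟨c.vertex, d.vertex, (coverProj V).mapPath p⟩ • (x : M) := by
  induction p with
  | nil => exact x.2.2.symm
  | @cons d e p a ih =>
    refine Eq.trans ?_ (M.cons_smul ((coverProj V).mapPath p) a.1 (x : M)).symm
    exact congrArg (ofPath k ⟨d.vertex, e.vertex, a.1.toPath⟩ • ·) ih

omit [Fintype V] in
-- With `toRep_map_coe`, this turns multiplication by a path of `V` into a structure map of the
-- representation.
theorem exists_lift_path {i j : V} (p : Path i j) {n m : ℤ} (h : m = n + p.length) :
    ∃ q : Path (⟨i, n⟩ : LevelCover V) ⟨j, m⟩, (coverProj V).mapPath q = p := by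
  induction p generalizing m with
  | nil =>
    obtain rfl : m = n := by simpa using h
    exact ⟨Path.nil, rfl⟩
  | cons p a ih =>
    obtain ⟨q, hq⟩ := ih rfl
    exact ⟨q.cons ⟨a, by rw [h, Path.length_cons]; push_cast; ring⟩, by
      rw [Prefunctor.mapPath_cons, hq]; rfl⟩

/-- The functor from graded modules to representations of the covering quiver. -/
noncomputable def repFunctor (k : Type u) [Field k] (V : Type v) [Quiver.{w} V] [Fintype V] :
    GrMod k V ⥤ Paths (LevelCover V) ⥤ ModuleCat.{u} k where
  obj M := M.toRep
  map f := Paths.natTransOfArrows (fun c => ModuleCat.ofHom (componentMap f c)) fun _ _ _ =>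
    ModuleCat.hom_ext (LinearMap.ext fun _ => Subtype.ext (map_smul f.toLinearMap _ _))
  map_id _ := rfl
  map_comp _ _ := rfl

instance : (repFunctor k V).Faithful where
  map_injective {M N f g} h := by
    refine Hom.ext (LinearMap.ext fun x => ?_)
    induction x using M.component_induction with
    | zero => rw [map_zero, map_zero]
    | add x y hx hy => rw [map_add, map_add, hx, hy]
    | mem c x hx =>
      have h₁ : componentMap f c = componentMap g c :=
        congrArg (fun t => (NatTrans.app t c).hom) h
      exact congrArg Subtype.val (LinearMap.congr_fun h₁ ⟨x, hx⟩)

open Classical in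
/-- The `k`-linear map with given values on the components. -/
noncomputable def ofComponents {M N : GrMod k V} (η : ∀ c, M.component c →ₗ[k] N.component c) :
    M →ₗ[k] N :=
  DirectSum.toModule k _ N (fun c => (N.component c).subtype ∘ₗ η c) ∘ₗ
    (LinearEquiv.ofBijective (DirectSum.coeLinearMap M.component)
      M.component_isInternal).symm.toLinearMap

theorem ofComponents_of_mem {M N : GrMod k V} (η : ∀ c, M.component c →ₗ[k] N.component c)
    {c : LevelCover V} (x : M.component c) : ofComponents η (x : M) = η c x := by
  classical
  have h : (LinearEquiv.ofBijective (DirectSum.coeLinearMap M.component)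
      M.component_isInternal).symm (x : M) = DirectSum.lof k _ (fun c => M.component c) c x := by
    rw [LinearEquiv.symm_apply_eq]
    exact (DirectSum.coeLinearMap_lof _ _ _).symm
  change DirectSum.toModule k _ N _ ((LinearEquiv.ofBijective _ _).symm (x : M)) = _
  rw [h, DirectSum.toModule_lof]
  rfl

/-- By linearity, one path and one element of a component suffice. A path starting at another vertex
kills both sides; otherwise the hypothesis is applied arrow by arrow. -/
theorem ofComponents_smul {M N : GrMod k V} (η : ∀ c, M.component c →ₗ[k] N.component c)
    (h : ∀ (c d : LevelCover V) (a : c ⟶ d) (x : M.component c),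
      η d (M.arrowMap a x) = N.arrowMap a (η c x)) (a : PathAlgebra k V) (x : M) :
    ofComponents η (a • x) = a • ofComponents η x := by
  induction a using PathAlgebra.induction_on with
  | zero => rw [zero_smul, zero_smul, map_zero]
  | add a b ha hb => rw [add_smul, add_smul, map_add, ha, hb]
  | smul r p =>
    rw [smul_assoc, smul_assoc, map_smul]
    congr 1
    induction x using M.component_induction with
    | zero => rw [smul_zero, map_zero, smul_zero]
    | add x y hx hy => rw [smul_add, map_add, map_add, hx, hy, smul_add]
    | mem c x hx =>
      obtain ⟨i, j, p⟩ := p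
      by_cases hi : i = c.vertex
      · obtain ⟨v, n⟩ := c
        subst hi
        induction p with
        | nil =>
          rw [hx.2, ofComponents_of_mem η ⟨x, hx⟩]
          exact (η _ ⟨x, hx⟩).2.2.symm
        | cons p a ih =>
          rw [cons_smul, cons_smul, ← ih]
          have hy := M.ofPath_smul_mem_component p hx.1
          rw [ofComponents_of_mem η ⟨_, hy⟩]
          let a' : (⟨_, p.length + n⟩ : LevelCover V) ⟶ ⟨_, p.length + n + 1⟩ := ⟨a, rfl⟩
          exact (ofComponents_of_mem η (M.arrowMap a' ⟨_, hy⟩)).trans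
            (congrArg Subtype.val (h _ _ a' ⟨_, hy⟩))
      · rw [M.ofPath_smul_of_ne _ hx hi, map_zero, ofComponents_of_mem η ⟨x, hx⟩,
          N.ofPath_smul_of_ne _ (η c ⟨x, hx⟩).2 hi]

instance : (repFunctor k V).Full where
  map_surjective {M N} η := by
    let η' : ∀ c, M.component c →ₗ[k] N.component c := fun c => (η.app c).hom
    have h : ∀ (c d : LevelCover V) (a : c ⟶ d) (x : M.component c),
        η' d (M.arrowMap a x) = N.arrowMap a (η' c x) := fun c d a x => by
      exact LinearMap.congr_fun (congrArg ModuleCat.Hom.hom (η.naturality ((Paths.of _).map a))) x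
    refine ⟨⟨{ toFun := ofComponents η', map_add' := map_add _,
               map_smul' := ofComponents_smul η' h }, fun n x hx => ?_⟩, ?_⟩
    · change ofComponents η' x ∈ _
      rw [← M.sum_idem_smul x, map_sum]
      refine Submodule.sum_mem _ fun i _ => ?_
      have hy : idem k i • x ∈ M.component ⟨i, n⟩ := by
        simpa using M.ofPath_smul_mem_component (Path.nil (a := i)) hx
      rw [ofComponents_of_mem η' ⟨_, hy⟩]
      exact (η' _ ⟨_, hy⟩).2.1
    · refine NatTrans.ext (funext fun c => ?_)
      refine ModuleCat.hom_ext (LinearMap.ext fun x => Subtype.ext ?_)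
      exact ofComponents_of_mem η' x

end GrMod

/-! ### Finite-dimensional torsion in terms of long paths -/

namespace GrMod

open PathAlgebra

theorem finite_paths_lt (V : Type v) [Quiver.{w} V] [Finite V] [∀ i j : V, Finite (i ⟶ j)]
    (n : ℕ) : {p : QPath V | p.path.length < n}.Finite := by
  induction n with
  | zero => simp
  | succ n ih =>
    have := ih.to_subtype
    refine ((Set.finite_range fun i : V => (⟨i, i, Path.nil⟩ : QPath V)).union
      (Set.finite_range fun x : Σ (p : {p : QPath V | p.path.length < n}) (j : V), p.1.tgt ⟶ j =>
        (⟨x.1.1.src, x.2.1, x.1.1.path.cons x.2.2⟩ : QPath V))).subset ?_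
    rintro ⟨i, j, p⟩ hp
    cases p with
    | nil => exact Or.inl ⟨i, rfl⟩
    | cons p a =>
      refine Or.inr ⟨⟨⟨⟨_, _, p⟩, ?_⟩, _, a⟩, rfl⟩
      simpa using hp

variable {k : Type u} [Field k] {V : Type v} [Quiver.{w} V] [Fintype V]

/-- The elements of a graded module that sufficiently long paths send into a given submodule. -/
def torsionOver (M : GrMod k V) (A : Submodule (PathAlgebra k V) M) :
    Submodule (PathAlgebra k V) M where
  carrier := {x | ∃ N : ℕ, ∀ p : QPath V, N ≤ p.path.length → ofPath k p • x ∈ A}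
  add_mem' := by
    rintro x y ⟨m, hm⟩ ⟨n, hn⟩
    exact ⟨max m n, fun p hp => by
      rw [smul_add]
      exact add_mem (hm p ((le_max_left _ _).trans hp)) (hn p ((le_max_right _ _).trans hp))⟩
  zero_mem' := ⟨0, fun p _ => by rw [smul_zero]; exact zero_mem _⟩
  smul_mem' := by
    rintro a x ⟨m, hm⟩
    induction a using PathAlgebra.induction_on with
    | zero => exact ⟨0, fun p _ => by rw [zero_smul, smul_zero]; exact zero_mem _⟩
    | add a b ha hb =>
      obtain ⟨m, hm⟩ := ha
      obtain ⟨n, hn⟩ := hb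
      exact ⟨max m n, fun p hp => by
        rw [add_smul, smul_add]
        exact add_mem (hm p ((le_max_left _ _).trans hp)) (hn p ((le_max_right _ _).trans hp))⟩
    | smul r q =>
      refine ⟨m, fun p hp => ?_⟩
      rw [smul_assoc, smul_base_comm, ← mul_smul]
      refine A.smul_of_tower_mem r ?_
      by_cases h : p.src = q.tgt
      · obtain ⟨i, j, p⟩ := p
        obtain ⟨i', j', q⟩ := q
        obtain rfl : i = j' := h
        rw [ofPath_mul_of_eq]
        exact hm _ (hp.trans (by rw [Path.length_comp]; exact Nat.le_add_left _ _))
      · rw [ofPath_mul_of_ne _ _ h, zero_smul]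
        exact zero_mem _

theorem mem_torsionOver {M : GrMod k V} {A : Submodule (PathAlgebra k V) M} {x : M} :
    x ∈ M.torsionOver A ↔
      ∃ N : ℕ, ∀ p : QPath V, N ≤ p.path.length → ofPath k p • x ∈ A := Iff.rfl

theorem exists_proj_eq_zero (M : GrMod k V) (x : M) : ∃ b : ℤ, ∀ n, b ≤ n → M.proj n x = 0 := by
  induction x using M.induction_on with
  | zero => exact ⟨0, fun n _ => map_zero _⟩
  | add x y hx hy =>
    obtain ⟨b, hb⟩ := hx
    obtain ⟨c, hc⟩ := hy
    exact ⟨max b c, fun n hn => by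
      rw [map_add, hb n ((le_max_left _ _).trans hn), hc n ((le_max_right _ _).trans hn),
        add_zero]⟩
  | mem i x hx => exact ⟨i + 1, fun n hn => M.proj_of_mem_ne (by omega) hx⟩

/-- A finite-dimensional graded submodule has degrees bounded above, so long paths push its elements
out of it. Conversely, if paths of length at least `n` kill a homogeneous `x`, then the graded
submodule generated by `x` is spanned by the images of `x` under the finitely many shorter paths. -/
theorem fdim_iff [∀ i j : V, Finite (i ⟶ j)] (M : GrMod k V) :
    Fdim k V M ↔ M.torsionOver ⊥ = ⊤ := by
  constructor
  · intro h
    rw [eq_top_iff, ← show _ = _ from h]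
    refine iSup₂_le fun N hN x hx => ?_
    obtain ⟨hgr, hfin⟩ := hN
    obtain ⟨s, hs⟩ := hfin.fg_top
    choose b hb using fun y : N => M.exists_proj_eq_zero y
    obtain ⟨B, hB⟩ := (s.image b).bddAbove
    have hzero : ∀ n, B ≤ n → ∀ y ∈ N, M.proj n y = 0 := fun n hn y hy => by
      have hy' : (⟨y, hy⟩ : N) ∈ Submodule.span k (s : Set N) := hs ▸ Submodule.mem_top
      have key : ∀ z ∈ Submodule.span k (s : Set N), M.proj n (z : M) = 0 := fun z hz => by
        induction hz using Submodule.span_induction with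
        | mem z hz => exact hb z n ((hB (Finset.mem_image_of_mem b hz)).trans hn)
        | zero => exact map_zero _
        | add z z' _ _ h h' => exact (map_add (M.proj n) (z : M) z').trans (by rw [h, h', add_zero])
        | smul r z _ h => exact (map_smul (M.proj n) r (z : M)).trans (by rw [h, smul_zero])
      exact key _ hy'
    obtain ⟨t, ht⟩ := M.exists_sum_proj x
    rw [ht]
    -- A path of length at least `B - i` moves degree `i` into degrees at least `B`, where `N`
    -- vanishes.
    refine Submodule.sum_mem _ fun i _ => ⟨(B - i).toNat, fun p hp => ?_⟩
    rw [Submodule.mem_bot, ← M.proj_of_mem (M.smul_mem _ _ _ _ (ofPath_mem_degree p)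
      (M.proj_mem i x))]
    exact hzero _ (by omega) _ (N.smul_mem _ (hgr i x hx))
  · intro h
    rw [Fdim, eq_top_iff]
    rintro x -
    induction x using M.induction_on with
    | zero => exact zero_mem _
    | add x y hx hy => exact add_mem hx hy
    | mem i x hx =>
      obtain ⟨n, hn⟩ := mem_torsionOver.1 (h ▸ Submodule.mem_top : x ∈ M.torsionOver ⊥)
      refine Submodule.mem_iSup_of_mem (Submodule.span (PathAlgebra k V) {x})
        (Submodule.mem_iSup_of_mem ⟨?_, ?_⟩ (Submodule.mem_span_singleton_self x))
      · intro j m hm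
        obtain ⟨a, rfl⟩ := Submodule.mem_span_singleton.1 hm
        clear hm
        induction a using PathAlgebra.induction_on with
        | zero => rw [zero_smul, map_zero]; exact zero_mem _
        | add a b ha hb => rw [add_smul, map_add]; exact add_mem ha hb
        | smul r p =>
          rw [smul_assoc, map_smul]
          refine Submodule.smul_of_tower_mem _ r ?_
          have hp := M.smul_mem _ _ _ _ (ofPath_mem_degree p) hx
          by_cases hj : p.path.length + i = j
          · subst hj
            rw [M.proj_of_mem hp]
            exact Submodule.smul_mem _ _ (Submodule.mem_span_singleton_self x)
          · rw [M.proj_of_mem_ne hj hp]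
            exact zero_mem _
      · let S : Submodule k M :=
          Submodule.span k ((fun p : QPath V => ofPath k p • x) '' {p | p.path.length < n})
        have hS : Module.Finite k S :=
          Module.Finite.span_of_finite k ((finite_paths_lt V n).image _)
        have hle : (Submodule.span (PathAlgebra k V) {x}).restrictScalars k ≤ S := by
          intro m hm
          obtain ⟨a, rfl⟩ := Submodule.mem_span_singleton.1
            ((Submodule.restrictScalars_mem k _ _).1 hm)
          clear hm
          induction a using PathAlgebra.induction_on with
          | zero => rw [zero_smul]; exact zero_mem _
          | add a b ha hb => rw [add_smul]; exact add_mem ha hb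
          | smul r p =>
            rw [smul_assoc]
            refine Submodule.smul_mem _ r ?_
            by_cases hp : p.path.length < n
            · exact Submodule.subset_span ⟨p, hp, rfl⟩
            · rw [show ofPath k p • x = 0 from hn p (not_lt.1 hp)]
              exact zero_mem _
        exact Submodule.finiteDimensional_of_le hle

theorem fdim_ker_iff [∀ i j : V, Finite (i ⟶ j)] {M N : GrMod k V} (f : M ⟶ N) :
    Fdim k V (ker f) ↔ ∀ x, f.toLinearMap x = 0 → x ∈ M.torsionOver ⊥ := by
  rw [fdim_iff, eq_top_iff]
  constructor
  · intro h x hx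
    obtain ⟨n, hn⟩ := h (x := (⟨x, hx⟩ : LinearMap.ker f.toLinearMap)) trivial
    exact ⟨n, fun p hp => congrArg Subtype.val (hn p hp :)⟩
  · rintro h ⟨x, hx⟩ -
    obtain ⟨n, hn⟩ := h x hx
    exact ⟨n, fun p hp => Subtype.ext (hn p hp :)⟩

theorem fdim_coker_iff [∀ i j : V, Finite (i ⟶ j)] {M N : GrMod k V} (f : M ⟶ N) :
    Fdim k V (coker f) ↔ ∀ y, y ∈ N.torsionOver (LinearMap.range f.toLinearMap) := by
  rw [fdim_iff, eq_top_iff]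
  constructor
  · intro h y
    obtain ⟨n, hn⟩ := h (x := (Submodule.Quotient.mk y : N ⧸ LinearMap.range f.toLinearMap)) trivial
    exact ⟨n, fun p hp => (Submodule.Quotient.mk_eq_zero _).1 (hn p hp :)⟩
  · intro h y _
    obtain ⟨y, rfl⟩ := Submodule.Quotient.mk_surjective (LinearMap.range f.toLinearMap) y
    obtain ⟨n, hn⟩ := h y
    exact ⟨n, fun p hp => (Submodule.Quotient.mk_eq_zero (LinearMap.range f.toLinearMap)).2 (hn p hp)⟩

theorem exists_component_map_eq {M N : GrMod k V} (f : M ⟶ N) {c : LevelCover V} {x : M}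
    {y : N} (hy : y ∈ N.component c) (h : f.toLinearMap x = y) :
    f.toLinearMap (M.toComponent c x) = y := by
  rw [map_toComponent, h, N.toComponent_of_mem hy]

/-- Torsion modulo a submodule can be tested on the components, along the paths of the covering
quiver. -/
theorem mem_torsionOver_component_iff (M : GrMod k V) (A : Submodule (PathAlgebra k V) M)
    {c : LevelCover V} {x : M} (hx : x ∈ M.component c) :
    x ∈ M.torsionOver A ↔ ∃ N : ℤ, ∀ (d : LevelCover V) (p : Path c d), N ≤ d.level →
      ofPath k ⟨c.vertex, d.vertex, (coverProj V).mapPath p⟩ • x ∈ A := by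
  have hlen : ∀ {d : LevelCover V} (p : Path c d),
      ((coverProj V).mapPath p).length = p.length := fun p => by
    induction p with
    | nil => rfl
    | cons p a ih => rw [Prefunctor.mapPath_cons, Path.length_cons, ih, Path.length_cons]
  constructor
  · rintro ⟨n, hn⟩
    refine ⟨c.level + n, fun d p hp => hn _ ?_⟩
    have h := LevelQuiver.level_path LevelCover.level_eq p
    have h' : ((coverProj V).mapPath p).length = p.length := hlen p
    change n ≤ ((coverProj V).mapPath p).length
    omega
  · rintro ⟨n, hn⟩
    refine ⟨(n - c.level).toNat, fun p hp => ?_⟩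
    by_cases h : p.src = c.vertex
    · obtain ⟨i, j, p⟩ := p
      obtain ⟨i', m⟩ := c
      obtain rfl : i = i' := h
      obtain ⟨q, hq⟩ := exists_lift_path p (n := m) rfl
      have h := hn _ q (by simp only at hp ⊢; omega)
      rwa [hq] at h
    · rw [M.ofPath_smul_of_ne p hx h]
      exact zero_mem _

theorem isoModFdim_iff [∀ i j : V, Finite (i ⟶ j)] {M N : GrMod k V} (f : M ⟶ N) :
    isoModFdim k V f ↔
      LevelQuiver.torsionIso k (LevelCover.level : LevelCover V → ℤ) ((repFunctor k V).map f) := by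
  rw [isoModFdim, fdim_ker_iff, fdim_coker_iff]
  constructor
  · rintro ⟨h₁, h₂⟩ c
    refine ⟨fun x hx => ?_, fun y => ?_⟩
    · have hx' : f.toLinearMap (Subtype.val (p := (· ∈ M.component c)) x) = 0 :=
        congrArg (Subtype.val (p := (· ∈ N.component c))) hx
      obtain ⟨n, hn⟩ := (M.mem_torsionOver_component_iff ⊥ (c := c) x.2).1 (h₁ _ hx')
      refine ⟨n, fun d g hd => Subtype.ext ?_⟩
      exact (M.toRep_map_coe g x).trans (hn d g hd)
    · obtain ⟨n, hn⟩ := (N.mem_torsionOver_component_iff _ (c := c) y.2).1 (h₂ y.1)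
      refine ⟨n, fun d g hd => ?_⟩
      obtain ⟨x, hx⟩ := hn d g hd
      rw [← N.toRep_map_coe g y] at hx
      -- The preimage `x` need not be homogeneous, but `f` commutes with `toComponent`, so its
      -- component at `d` is still a preimage.
      exact ⟨M.toComponent d x, Subtype.ext (exists_component_map_eq f (Subtype.prop _) hx)⟩
  · intro h
    constructor
    · intro x hx
      obtain ⟨s, hs⟩ := M.exists_sum_proj x
      rw [hs]
      refine Submodule.sum_mem _ fun n _ => ?_
      rw [← M.sum_idem_smul (M.proj n x)]
      refine Submodule.sum_mem _ fun i _ => ?_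
      let c : LevelCover V := ⟨i, n⟩
      have hc : f.toLinearMap (M.toComponent c x) = 0 := by
        rw [map_toComponent, hx, map_zero]; rfl
      obtain ⟨m, hm⟩ := (h c).1 (M.toComponent c x) (Subtype.ext hc)
      refine (M.mem_torsionOver_component_iff ⊥ (M.toComponent c x).2).2 ⟨m, fun d p hp => ?_⟩
      rw [← M.toRep_map_coe p]
      exact congrArg (Subtype.val (p := (· ∈ M.component d))) (hm d p hp)
    · intro y
      induction y using N.component_induction with
      | zero => exact zero_mem _
      | add x y hx hy => exact add_mem hx hy
      | mem c y hy =>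
        obtain ⟨m, hm⟩ := (h c).2 ⟨y, hy⟩
        refine (N.mem_torsionOver_component_iff _ hy).2 ⟨m, fun d p hp => ?_⟩
        obtain ⟨x, hx⟩ := hm d p hp
        refine ⟨Subtype.val (p := (· ∈ M.component d)) x, ?_⟩
        exact (congrArg (Subtype.val (p := (· ∈ N.component d))) hx).trans
          (N.toRep_map_coe p ⟨y, hy⟩)

end GrMod

/-! ### The graded module of a representation -/

namespace GrMod

variable {k : Type u} [Field k] {V : Type v} [Quiver.{w} V] [Fintype V]

/-- A graded module from a representation of the path algebra on a graded vector space. -/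
noncomputable def ofAlgHom {S : Type u} [AddCommGroup S] [Module k S]
    (σ : PathAlgebra k V →ₐ[k] Module.End k S) (A : ℤ → Submodule k S)
    (hA : DirectSum.IsInternal A)
    (hσ : ∀ (p : QPath V) (i : ℤ), ∀ s ∈ A i,
      σ (PathAlgebra.ofPath k p) s ∈ A (p.path.length + i)) : GrMod k V :=
  letI : Module (PathAlgebra k V) S := Module.compHom S σ.toRingHom
  { carrier := S
    isScalarTower := ⟨fun c a s => by
      change σ (c • a) s = c • σ a s
      rw [map_smul, LinearMap.smul_apply]⟩
    grading := A
    isInternal := hA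
    smul_mem := fun n i a s ha hs => by
      change σ a s ∈ _
      induction ha using Submodule.span_induction with
      | mem a h =>
        obtain ⟨p, rfl, rfl⟩ := h
        exact hσ p i s hs
      | zero => rw [map_zero]; exact zero_mem _
      | add a b _ _ ha hb => rw [map_add]; exact add_mem ha hb
      | smul c a _ ha => rw [map_smul]; exact Submodule.smul_mem _ _ ha }

end GrMod

namespace LevelCover

variable {k : Type u} [Field k] {V : Type v} (E : LevelCover V → Type u)
  [∀ c, AddCommGroup (E c)] [∀ c, Module k (E c)]

/-- The index set is countable, so the product containing the direct sum is `u`-small. This is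
needed because a `GrMod` has its carrier in the universe of `k`, whatever the universe of `V`. -/
instance [Finite V] : Small.{u} (DirectSum (LevelCover V) E) :=
  small_of_injective (β := ∀ c : LevelCover V, E c) (f := fun t c => t c) DFunLike.coe_injective

variable (k)

open Classical in
/-- The inclusion of a summand. -/
noncomputable def incl (c : LevelCover V) : E c →ₗ[k] DirectSum (LevelCover V) E :=
  DirectSum.lof k (LevelCover V) E c

variable {E}

theorem incl_injective (c : LevelCover V) : Function.Injective (incl k E c) := by
  classical
  exact DirectSum.of_injective c

theorem directSum_induction {P : DirectSum (LevelCover V) E → Prop}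
    (t : DirectSum (LevelCover V) E) (zero : P 0) (add : ∀ s t, P s → P t → P (s + t))
    (incl : ∀ c x, P (incl k E c x)) : P t := by
  classical
  exact DirectSum.induction_on t zero incl add

variable {k}

theorem linearMap_ext {F : Type*} [AddCommGroup F] [Module k F]
    {f g : DirectSum (LevelCover V) E →ₗ[k] F}
    (h : ∀ c x, f (incl k E c x) = g (incl k E c x)) : f = g := by
  refine LinearMap.ext fun t => ?_
  induction t using directSum_induction (E := E) k with
  | zero => rw [map_zero, map_zero]
  | add s t hs ht => rw [map_add, map_add, hs, ht]
  | incl c x => exact h c x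

variable (k E)

open Classical in
/-- The projection onto the summands at the vertices that satisfy a predicate. -/
noncomputable def sumProj (P : LevelCover V → Prop) : Module.End k (DirectSum (LevelCover V) E) :=
  DirectSum.toModule k _ _ fun c => if P c then incl k E c else 0

variable {E}

theorem sumProj_of_pos {P : LevelCover V → Prop} {c : LevelCover V} (h : P c) (x : E c) :
    sumProj k E P (incl k E c x) = incl k E c x := by
  classical
  rw [sumProj, incl, DirectSum.toModule_lof, if_pos h]
  rfl

theorem sumProj_of_neg {P : LevelCover V → Prop} {c : LevelCover V} (h : ¬ P c) (x : E c) :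
    sumProj k E P (incl k E c x) = 0 := by
  classical
  rw [sumProj, incl, DirectSum.toModule_lof, if_neg h]
  rfl

theorem sumProj_vertex_same {i : V} {c : LevelCover V} (h : c.vertex = i) (x : E c) :
    sumProj k E (fun c => c.vertex = i) (incl k E c x) = incl k E c x :=
  sumProj_of_pos k (P := fun c => c.vertex = i) h x

theorem sumProj_vertex_ne {i : V} {c : LevelCover V} (h : c.vertex ≠ i) (x : E c) :
    sumProj k E (fun c => c.vertex = i) (incl k E c x) = 0 :=
  sumProj_of_neg k (P := fun c => c.vertex = i) h x

variable (E) in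
/-- The sum of the summands of a given level. -/
def levelPart (n : ℤ) : Submodule k (DirectSum (LevelCover V) E) :=
  Submodule.span k {t | ∃ (c : LevelCover V) (x : E c), c.level = n ∧ t = incl k E c x}

theorem incl_mem_levelPart (c : LevelCover V) (x : E c) : incl k E c x ∈ levelPart k E c.level :=
  Submodule.subset_span ⟨c, x, rfl, rfl⟩

theorem sumProj_level_of_mem {n : ℤ} {t : DirectSum (LevelCover V) E} (ht : t ∈ levelPart k E n) :
    sumProj k E (fun c => c.level = n) t = t := by
  induction ht using Submodule.span_induction with
  | mem t h =>
    obtain ⟨c, x, hc, rfl⟩ := h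
    exact sumProj_of_pos k hc x
  | zero => exact map_zero _
  | add s t _ _ hs ht => rw [map_add, hs, ht]
  | smul r t _ ht => rw [map_smul, ht]

theorem sumProj_level_of_mem_ne {n m : ℤ} (hnm : n ≠ m) {t : DirectSum (LevelCover V) E}
    (ht : t ∈ levelPart k E n) : sumProj k E (fun c => c.level = m) t = 0 := by
  induction ht using Submodule.span_induction with
  | mem t h =>
    obtain ⟨c, x, hc, rfl⟩ := h
    exact sumProj_of_neg k (hc.trans_ne hnm) x
  | zero => exact map_zero _
  | add s t _ _ hs ht => rw [map_add, hs, ht, add_zero]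
  | smul r t _ ht => rw [map_smul, ht, smul_zero]

theorem sumProj_vertex_of_mem {i : V} {n : ℤ} {t : DirectSum (LevelCover V) E}
    (ht : t ∈ levelPart k E n) :
    sumProj k E (fun c => c.vertex = i) t ∈ LinearMap.range (incl k E ⟨i, n⟩) := by
  induction ht using Submodule.span_induction with
  | mem t h =>
    obtain ⟨⟨j, n⟩, x, rfl, rfl⟩ := h
    by_cases hi : j = i
    · subst hi
      exact ⟨x, (sumProj_vertex_same k (c := ⟨j, n⟩) rfl x).symm⟩
    · rw [sumProj_vertex_ne k (c := ⟨j, n⟩) hi]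
      exact zero_mem _
  | zero => rw [map_zero]; exact zero_mem _
  | add s t _ _ hs ht => rw [map_add]; exact add_mem hs ht
  | smul r t _ ht => rw [map_smul]; exact Submodule.smul_mem _ _ ht

variable {k}

theorem sumProj_mul_self (i : V) : sumProj k E (fun c => c.vertex = i) *
    sumProj k E (fun c => c.vertex = i) = sumProj k E (fun c => c.vertex = i) := by
  refine linearMap_ext fun c x => ?_
  change sumProj k E _ (sumProj k E _ _) = _
  by_cases hi : c.vertex = i
  · rw [sumProj_vertex_same k hi, sumProj_vertex_same k hi]
  · rw [sumProj_vertex_ne k hi, map_zero]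

theorem sumProj_mul_of_ne {i j : V} (h : i ≠ j) : sumProj k E (fun c => c.vertex = i) *
    sumProj k E (fun c => c.vertex = j) = 0 := by
  refine linearMap_ext fun c x => ?_
  change sumProj k E _ (sumProj k E _ _) = 0
  by_cases hi : c.vertex = j
  · rw [sumProj_vertex_same k hi, sumProj_vertex_ne k (hi.trans_ne h.symm)]
  · rw [sumProj_vertex_ne k hi, map_zero]

variable [Quiver.{w} V] (m : ∀ c d : LevelCover V, (c ⟶ d) → E c →ₗ[k] E d)

open Classical in
/-- The action of an arrow. -/
noncomputable def arrowAct {i j : V} (a : i ⟶ j) : Module.End k (DirectSum (LevelCover V) E) :=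
  DirectSum.toModule k _ _ fun c => if h : c.vertex = i then
    incl k E ⟨j, c.level + 1⟩ ∘ₗ m c ⟨j, c.level + 1⟩ ⟨h ▸ a, rfl⟩ else 0

theorem arrowAct_incl {c d : LevelCover V} (a : c ⟶ d) (x : E c) :
    arrowAct m a.1 (incl k E c x) = incl k E d (m c d a x) := by
  classical
  obtain ⟨j, n⟩ := d
  obtain ⟨a, h⟩ := a
  obtain rfl : n = c.level + 1 := h
  rw [arrowAct, incl, DirectSum.toModule_lof, dif_pos rfl]
  rfl

theorem arrowAct_ne {i j : V} (a : i ⟶ j) {c : LevelCover V} (h : c.vertex ≠ i) (x : E c) :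
    arrowAct m a (incl k E c x) = 0 := by
  classical
  rw [arrowAct, incl, DirectSum.toModule_lof, dif_neg h]
  rfl

theorem arrowAct_mem_levelPart {i j : V} (a : i ⟶ j) {n : ℤ} {t : DirectSum (LevelCover V) E}
    (ht : t ∈ levelPart k E n) : arrowAct m a t ∈ levelPart k E (n + 1) := by
  induction ht using Submodule.span_induction with
  | mem t h =>
    obtain ⟨⟨i', n⟩, x, rfl, rfl⟩ := h
    by_cases hi : i' = i
    · subst hi
      have h := arrowAct_incl m (c := ⟨i', n⟩) (d := ⟨j, n + 1⟩) ⟨a, rfl⟩ x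
      rw [h]
      exact incl_mem_levelPart k (⟨j, n + 1⟩ : LevelCover V) _
    · rw [arrowAct_ne m a (c := ⟨i', n⟩) hi]
      exact zero_mem _
  | zero => rw [map_zero]; exact zero_mem _
  | add s t _ _ hs ht => rw [map_add]; exact add_mem hs ht
  | smul r t _ ht => rw [map_smul]; exact Submodule.smul_mem _ _ ht

theorem sumProj_mul_arrowAct {i j : V} (a : i ⟶ j) :
    sumProj k E (fun c => c.vertex = j) * arrowAct m a = arrowAct m a := by
  refine linearMap_ext fun ⟨i', n⟩ x => ?_
  change sumProj k E _ (arrowAct m a _) = _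
  by_cases hi : i' = i
  · subst hi
    have h := arrowAct_incl m (c := ⟨i', n⟩) (d := ⟨j, n + 1⟩) ⟨a, rfl⟩ x
    rw [h, sumProj_vertex_same k (c := ⟨j, n + 1⟩) rfl]
  · rw [arrowAct_ne m a (c := ⟨i', n⟩) hi, map_zero]

/-- The action of a path. -/
noncomputable def pathAct {i : V} :
    ∀ {j : V}, Path i j → Module.End k (DirectSum (LevelCover V) E)
  -- A trivial path acts as the idempotent of its vertex, not as the identity.
  | _, Path.nil => sumProj k E fun c => c.vertex = i
  | _, Path.cons p a => arrowAct m a * pathAct p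

theorem pathAct_mem_levelPart {i j : V} (p : Path i j) {n : ℤ} {t : DirectSum (LevelCover V) E}
    (ht : t ∈ levelPart k E n) : pathAct m p t ∈ levelPart k E (p.length + n) := by
  induction p with
  | nil =>
    obtain ⟨x, hx⟩ := sumProj_vertex_of_mem k (i := i) ht
    have h : pathAct m (Path.nil : Path i i) t = _ := hx.symm
    rw [h, Path.length_nil, Nat.cast_zero, zero_add]
    exact incl_mem_levelPart k _ x
  | cons p a ih =>
    have h := arrowAct_mem_levelPart m a ih
    rw [Path.length_cons, Nat.cast_succ, add_right_comm]
    exact h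

theorem sumProj_mul_pathAct {i j : V} (p : Path i j) :
    sumProj k E (fun c => c.vertex = j) * pathAct m p = pathAct m p := by
  cases p with
  | nil => exact sumProj_mul_self i
  | cons p a =>
    change _ * (_ * _) = _ * _
    rw [← mul_assoc, sumProj_mul_arrowAct]

theorem pathAct_mul_sumProj {i j : V} (p : Path i j) :
    pathAct m p * sumProj k E (fun c => c.vertex = i) = pathAct m p := by
  induction p with
  | nil => exact sumProj_mul_self i
  | cons p a ih =>
    change _ * _ * _ = _ * _
    rw [mul_assoc, ih]

theorem pathAct_comp {i j l : V} (p : Path i j) (q : Path j l) :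
    pathAct m (p.comp q) = pathAct m q * pathAct m p := by
  induction q with
  | nil => exact (sumProj_mul_pathAct m p).symm
  | cons q a ih =>
    change _ * _ = _ * _ * _
    rw [ih, mul_assoc]

/-- Each action absorbs the idempotents at its two ends, and idempotents at distinct vertices are
orthogonal. -/
theorem pathAct_mul_of_ne (q p : QPath V) (h : q.src ≠ p.tgt) :
    pathAct m q.path * pathAct m p.path = 0 := by
  rw [← pathAct_mul_sumProj, ← sumProj_mul_pathAct m p.path, mul_assoc, ← mul_assoc (sumProj k E _),
    sumProj_mul_of_ne h, zero_mul, mul_zero]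

/-- The action of the path algebra as a linear map. -/
noncomputable def algebraAct : PathAlgebra k V →ₗ[k] Module.End k (DirectSum (LevelCover V) E) :=
  (Finsupp.linearCombination k fun p : QPath V => pathAct m p.path :
    (QPath V →₀ k) →ₗ[k] Module.End k (DirectSum (LevelCover V) E))

theorem algebraAct_ofPath (p : QPath V) :
    algebraAct m (PathAlgebra.ofPath k p) = pathAct m p.path :=
  (Finsupp.linearCombination_single k (1 : k) p).trans (one_smul k _)

variable [Fintype V]

theorem algebraAct_one : algebraAct m 1 = 1 := by
  rw [PathAlgebra.one_def, map_sum]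
  refine linearMap_ext fun c x => ?_
  rw [LinearMap.sum_apply, Finset.sum_eq_single c.vertex]
  · rw [algebraAct_ofPath]
    exact sumProj_vertex_same k rfl x
  · intro i _ hi
    rw [algebraAct_ofPath]
    exact sumProj_vertex_ne k (Ne.symm hi) x
  · simp

theorem algebraAct_mul (x y : PathAlgebra k V) :
    algebraAct m (x * y) = algebraAct m x * algebraAct m y := by
  induction x using PathAlgebra.induction_on with
  | zero => simp only [zero_mul, map_zero]
  | add x x' hx hx' => simp only [add_mul, map_add, hx, hx']
  | smul c q =>
    induction y using PathAlgebra.induction_on with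
    | zero => simp only [mul_zero, map_zero]
    | add y y' hy hy' => simp only [mul_add, map_add, hy, hy']
    | smul d p =>
      rw [smul_mul_assoc, mul_smul_comm, map_smul, map_smul, map_smul, map_smul, smul_mul_assoc,
        mul_smul_comm, algebraAct_ofPath, algebraAct_ofPath]
      congr 2
      by_cases h : q.src = p.tgt
      · obtain ⟨i, j, p⟩ := p
        obtain ⟨j', l, q⟩ := q
        obtain rfl : j' = j := h
        rw [PathAlgebra.ofPath_mul_of_eq, algebraAct_ofPath, pathAct_comp]
      · rw [PathAlgebra.ofPath_mul_of_ne _ _ h, map_zero, pathAct_mul_of_ne m _ _ h]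

/-- The direct sum, in the universe of its summands. -/
noncomputable def shrinkEquiv (k : Type u) [Field k] (E : LevelCover V → Type u)
    [∀ c, AddCommGroup (E c)] [∀ c, Module k (E c)] :
    Shrink.{u} (DirectSum (LevelCover V) E) ≃ₗ[k] DirectSum (LevelCover V) E :=
  Shrink.linearEquiv k _

/-- The graded module of a representation of the covering quiver. -/
noncomputable def totalModule : GrMod k V :=
  GrMod.ofAlgHom (S := Shrink.{u} (DirectSum (LevelCover V) E))
    (((shrinkEquiv k E).symm.conjAlgEquiv k).toAlgHom.comp
      (AlgHom.ofLinearMap (algebraAct m) (algebraAct_one m) (algebraAct_mul m)))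
    (fun n => (levelPart k E n).comap (shrinkEquiv k E).toLinearMap)
    (by
      rw [DirectSum.isInternal_submodule_iff_iSupIndep_and_iSup_eq_top]
      constructor
      · refine GrMod.iSupIndep_of_proj _
          (fun n => sumProj k E (fun c => c.level = n) ∘ₗ (shrinkEquiv k E).toLinearMap) ?_ ?_
        · intro i s hs h
          have h' : shrinkEquiv k E s = 0 := (sumProj_level_of_mem k hs).symm.trans h
          exact (LinearEquiv.map_eq_zero_iff _).1 h'
        · intro i j hij s hs
          exact sumProj_level_of_mem_ne k hij hs
      · rw [eq_top_iff]
        rintro s -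
        obtain ⟨t, rfl⟩ := (shrinkEquiv k E).symm.surjective s
        induction t using directSum_induction (E := E) k with
        | zero => rw [map_zero]; exact zero_mem _
        | add s t hs ht => rw [map_add]; exact add_mem hs ht
        | incl c x =>
          refine Submodule.mem_iSup_of_mem c.level ?_
          rw [Submodule.mem_comap, LinearEquiv.coe_coe, LinearEquiv.apply_symm_apply]
          exact incl_mem_levelPart k c x)
    (fun p i s hs => by
      change shrinkEquiv k E ((shrinkEquiv k E).symm
        (algebraAct m (PathAlgebra.ofPath k p) (shrinkEquiv k E s))) ∈
          levelPart k E (p.path.length + i)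
      rw [LinearEquiv.apply_symm_apply, algebraAct_ofPath]
      exact pathAct_mem_levelPart m p.path hs)

/-- The underlying vector space of the graded module of a representation. -/
noncomputable def totalEquiv : totalModule m ≃ₗ[k] DirectSum (LevelCover V) E :=
  shrinkEquiv k E

theorem mem_grading_totalModule {n : ℤ} {s : totalModule m} :
    s ∈ (totalModule m).grading n ↔ totalEquiv m s ∈ levelPart k E n := Iff.rfl

theorem totalEquiv_ofPath_smul (p : QPath V) (s : totalModule m) :
    totalEquiv m (PathAlgebra.ofPath k p • s) = pathAct m p.path (totalEquiv m s) := by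
  rw [← algebraAct_ofPath]
  exact (shrinkEquiv k E).apply_symm_apply _

/-- The inclusion of a space of a representation as a component of the graded module. -/
noncomputable def toTotal (c : LevelCover V) : E c →ₗ[k] (totalModule m).component c where
  toFun x := ⟨(totalEquiv m).symm (incl k E c x), by
    refine ⟨?_, (totalEquiv m).injective ?_⟩
    · rw [mem_grading_totalModule, LinearEquiv.apply_symm_apply]
      exact incl_mem_levelPart k c x
    · rw [totalEquiv_ofPath_smul, LinearEquiv.apply_symm_apply]
      exact sumProj_vertex_same k rfl x⟩
  map_add' x y := Subtype.ext
    ((congrArg (totalEquiv m).symm (map_add (incl k E c) x y)).trans (map_add _ _ _))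
  map_smul' r x := Subtype.ext
    ((congrArg (totalEquiv m).symm (map_smul (incl k E c) r x)).trans (map_smul _ _ _))

theorem totalEquiv_toTotal (c : LevelCover V) (x : E c) :
    totalEquiv m (toTotal m c x : (totalModule m).component c).1 = incl k E c x :=
  (totalEquiv m).apply_symm_apply _

/-- For surjectivity, an element of degree `c.level` fixed by the idempotent at `c.vertex` equals
its own vertex projection, which lies in the summand at `c`. -/
theorem toTotal_bijective (c : LevelCover V) : Function.Bijective (toTotal m c) := by
  constructor
  · intro x y h
    refine incl_injective k c ?_
    rw [← totalEquiv_toTotal m, h, totalEquiv_toTotal]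
  · rintro ⟨s, hs, hs'⟩
    have h := congrArg (totalEquiv m) hs'
    rw [totalEquiv_ofPath_smul] at h
    obtain ⟨x, hx⟩ := sumProj_vertex_of_mem k (i := c.vertex) ((mem_grading_totalModule m).1 hs)
    refine ⟨x, Subtype.ext ((totalEquiv m).injective ?_)⟩
    rw [totalEquiv_toTotal]
    exact hx.trans h

theorem arrowMap_toTotal {c d : LevelCover V} (a : c ⟶ d) (x : E c) :
    (totalModule m).arrowMap a (toTotal m c x) = toTotal m d (m c d a x) := by
  refine Subtype.ext ((totalEquiv m).injective ?_)
  rw [totalEquiv_toTotal]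
  refine (totalEquiv_ofPath_smul m ⟨c.vertex, d.vertex, a.1.toPath⟩ _).trans ?_
  rw [totalEquiv_toTotal, ← arrowAct_incl]
  exact congrArg (arrowAct m a.1) (sumProj_vertex_same k rfl x)

end LevelCover

/-! ### The equivalence with representations modulo torsion, and the conclusion -/

namespace GrMod

variable {k : Type u} [Field k] {V : Type v} [Quiver.{w} V] [Fintype V]

instance : (repFunctor k V).EssSurj where
  mem_essImage X := by
    let E : LevelCover V → Type u := fun c => X.obj ((Paths.of _).obj c)
    let m : ∀ c d : LevelCover V, (c ⟶ d) → E c →ₗ[k] E d :=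
      fun _ _ a => (X.map ((Paths.of _).map a)).hom
    let η : X ⟶ (LevelCover.totalModule m).toRep :=
      Paths.natTransOfArrows (fun c => ModuleCat.ofHom (LevelCover.toTotal m c)) fun c d a =>
        ModuleCat.hom_ext (LinearMap.ext fun x => (LevelCover.arrowMap_toTotal m a x).symm)
    have (c : Paths (LevelCover V)) : IsIso (η.app c) :=
      (LinearEquiv.ofBijective (LevelCover.toTotal m c)
        (LevelCover.toTotal_bijective m c)).toModuleIso.isIso_hom
    have : IsIso η := NatIso.isIso_of_isIso_app η
    exact ⟨_, ⟨(asIso η).symm⟩⟩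

instance : (repFunctor k V).IsEquivalence where

/-- `QGr kQ` is the category of representations of the covering quiver modulo torsion. -/
theorem nonempty_qgr_equivalence [∀ i j : V, Finite (i ⟶ j)] :
    Nonempty (QGr k V ≌
      (LevelQuiver.torsionIso k (LevelCover.level : LevelCover V → ℤ)).Localization) :=
  -- After `symm`, the inverse of `repFunctor` is the left adjoint, so `repFunctor` plays the role
  -- of `F`.
  localization_equivalence_of_adjunction (repFunctor k V).asEquivalence.symm.toAdjunction _ _
    (fun _ _ f => isoModFdim_iff f) fun _ _ f _ => LevelQuiver.torsionIso_of_isIso k _ f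

end GrMod

theorem corollary1p3 {k : Type*} [Field k]
    {V : Type*} [Quiver V] [Fintype V] [DecidableEq V] [∀ i j : V, Fintype (i ⟶ j)]
    {V' : Type*} [Quiver V'] [Fintype V'] [DecidableEq V'] [∀ i j : V', Fintype (i ⟶ j)]
    (h : ShiftEquivalent (incidenceMatrix V) (incidenceMatrix V')) :
    Nonempty (QGr k V ≌ QGr k V') := by
  obtain ⟨e⟩ := GrMod.nonempty_qgr_equivalence (k := k) (V := V)
  obtain ⟨e'⟩ := GrMod.nonempty_qgr_equivalence (k := k) (V := V')
  obtain ⟨f⟩ := h.nonempty_localization_equivalence k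
  exact ⟨e.trans (f.trans e'.symm)⟩
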